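/- Let $U\subseteq\mathbb C^2$ be a nonempty open set with coordinates $(x,y)$, let $\mathfrak D$ be the algebra of differential operators $T=\sum_{i,j} f_{ij}\,\partial_x^i\partial_y^j$ (finite sums) with $f_{ij}\in C^\infty(U,\mathbb C)$, acting on $C^\infty(U,\mathbb C)$ (with $\partial_x,\partial_y$ the derivatives with respect to the complex coordinates), and let $\mathfrak D^{(k)}$ be the operators of order at most $k$. Let $r\ge 2$ and $p,q\ge 0$ be integers and $$\mathcal S=\mathcal S^r_{p,q}=\operatorname{span}\{x^iy^j : i,j\ge 0,\ i+rj\le p,\ j\le q\}.$$ Let $\mathfrak S\subset\mathfrak D$ be the operators that map $\mathcal S$ into itself, $\ker\pi\subset\mathfrak S$ the kernel of the restriction map $\pi:\mathfrak S\to\operatorname{End}(\mathcal S)$, and $$\tilde{\mathfrak S}=\Big\{T\in\mathfrak S : T=\sum_{i+rj\le p,\ j\le q} f_{ij}\,\partial_x^i\partial_y^j\Big\}.$$ An operator $T$ with polynomial coefficients has bidegree $(a,b)\in\mathbb Z^2$ if $T(x^iy^j)\in\langle x^{i+a}y^{j+b}\rangle$ for all $i,j\ge0$ (to be read as $T(x^iy^j)=0$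 if $i+a<0$ or $j+b<0$); $b$ is its $y$-degree. Let $\tilde{\mathfrak S}^{\downarrow}$ be the set of $T\in\tilde{\mathfrak S}$ that are sums of operators of nonpositive $y$-degree. Let $\mathfrak g^{24,r}_p$ be the Lie algebra spanned by the $r+5$ generators $$J^1=\partial_x,\quad J^2=x^2\partial_x+rxy\,\partial_y-px,\quad J^3=x\partial_x-\tfrac p2,\quad J^4=y\partial_y,\quad J^{5+i}=x^i\partial_y\ (0\le i\le r).$$ A polynomial of degree at most $k$ in the generators is a linear combination of ordered monomials $(J^1)^{K_1}\cdots(J^{5+r})^{K_{5+r}}$ with $K_1+\dots+K_{5+r}\le k$. Then $\mathfrak S=\tilde{\mathfrak S}\oplus\ker\pi$, and the following hold. 1. If $T\in\tilde{\mathfrak S}^{\downarrow}\cap\mathfrak D^{(k)}$ with $k\le q$ and $rk\le p$ (the latter follows from $k\le q$ if, as usual, $rq\le p$), then $T$ is a polynomial of degree at most $k$ in the generators of $\mathfrak g^{24,r}_p$. 2. If $T\in\tilde{\mathfrak S}^{\downarrow}\cap\mathfrak D^{(k)}$ with $k$ arbitrary (in particular if $k>q$), then $T$ is the projection onto $\tilde{\mathfrak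 S}$ along $\ker\pi$ of a polynomial of degree at most $k$ in the generators of $\mathfrak g^{24,r}_p$. In both cases, if $T$ has order exactly $k$, the polynomial has degree exactly $k$. 3. No $T\in\tilde{\mathfrak S}\setminus\tilde{\mathfrak S}^{\downarrow}$, and no nonzero $T\in\tilde{\mathfrak S}$ having a bidegree with positive $y$-degree, is the sum of a polynomial in the generators of $\mathfrak g^{24,r}_p$ (of any degree, factors in any order) and an operator in $\ker\pi$. For example, if $r=2$, $p\ge2$ and $q=\lfloor p/2\rfloor$, then $y\partial_x^2$ lies in $\tilde{\mathfrak S}$, has bidegree $(-2,1)$, and is not such a sum. -/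

import Mathlib

open TopologicalSpace
open scoped ContDiff

noncomputable section

namespace Staircase

/-- Extension by zero of a function on `U`; only its restriction to `U` matters. -/
def extZero (U : Opens (ℂ × ℂ)) (f : U → ℂ) : ℂ × ℂ → ℂ :=
  open Classical in fun z => if h : z ∈ U then f ⟨z, h⟩ else 0

theorem extZero_apply (U : Opens (ℂ × ℂ)) (f : U → ℂ) {z : ℂ × ℂ} (h : z ∈ U) :
    extZero U f z = f ⟨z, h⟩ := by
  simp [extZero, h]

/-- The algebra `C^∞(U, ℂ)` of (real-)smooth complex-valued functions on `U ⊆ ℂ²`. -/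
def Smooth (U : Opens (ℂ × ℂ)) : Subalgebra ℂ (U → ℂ) where
  carrier := {f | ContDiffOn ℝ ∞ (extZero U f) U}
  mul_mem' {f g} hf hg := by
    refine ContDiffOn.congr (ContDiffOn.mul hf hg) fun z hz => ?_
    have hz' : z ∈ U := hz
    simp [extZero_apply U _ hz']
  add_mem' {f g} hf hg := by
    refine ContDiffOn.congr (ContDiffOn.add hf hg) fun z hz => ?_
    have hz' : z ∈ U := hz
    simp [extZero_apply U _ hz']
  algebraMap_mem' c := by
    refine ContDiffOn.congr (contDiffOn_const (c := c)) fun z hz => ?_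
    have hz' : z ∈ U := hz
    simp [extZero_apply U _ hz']

/-- The derivative `(D_v g - i D_{iv} g) / 2`.  For `v = (1,0)` and `v = (0,1)` these are the
operators `∂/∂x` and `∂/∂y` of the complex coordinates `x, y` on smooth functions; on holomorphic
functions they are the complex partial derivatives. -/
def wirtinger (v : ℂ × ℂ) (g : ℂ × ℂ → ℂ) (z : ℂ × ℂ) : ℂ :=
  (fderiv ℝ g z v - Complex.I * fderiv ℝ g z (Complex.I • v)) / 2

theorem differentiableAt_extZero {U : Opens (ℂ × ℂ)} (f : Smooth U) {z : ℂ × ℂ} (hz : z ∈ U) :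
    DifferentiableAt ℝ (extZero U f) z :=
  ((f.2 : ContDiffOn ℝ ∞ (extZero U f) U).contDiffAt (U.isOpen.mem_nhds hz)).differentiableAt
    (by simp)

theorem contDiffOn_wirtinger {U : Opens (ℂ × ℂ)} (v : ℂ × ℂ) (f : Smooth U) :
    ContDiffOn ℝ ∞ (wirtinger v (extZero U f)) U := by
  have h : ContDiffOn ℝ ∞ (fderiv ℝ (extZero U f)) U :=
    ContDiffOn.fderiv_of_isOpen f.2 U.isOpen (by simp)
  have h1 := h.clm_apply (contDiffOn_const (c := v))
  have h2 := h.clm_apply (contDiffOn_const (c := Complex.I • v))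
  exact (h1.sub (contDiffOn_const.mul h2)).div_const 2

theorem extZero_add {U : Opens (ℂ × ℂ)} (f g : U → ℂ) :
    extZero U (f + g) = extZero U f + extZero U g := by
  funext z
  by_cases h : z ∈ U <;> simp [extZero, h]

theorem extZero_smul {U : Opens (ℂ × ℂ)} (c : ℂ) (f : U → ℂ) :
    extZero U (c • f) = c • extZero U f := by
  funext z
  by_cases h : z ∈ U <;> simp [extZero, h]

/-- The partial derivative in the complex direction `v`, as an operator on `C^∞(U, ℂ)`. -/
def partialD (U : Opens (ℂ × ℂ)) (v : ℂ × ℂ) : Module.End ℂ (Smooth U) where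
  toFun f := ⟨fun z => wirtinger v (extZero U f) z, by
    refine ContDiffOn.congr (contDiffOn_wirtinger v f) fun z hz => ?_
    have hz' : z ∈ U := hz
    simp [extZero_apply U _ hz']⟩
  map_add' f g := by
    ext z
    have hf := differentiableAt_extZero f z.2
    have hg := differentiableAt_extZero g z.2
    simp only [wirtinger, AddMemClass.coe_add, extZero_add, fderiv_add hf hg,
      add_apply, Pi.add_apply]
    ring
  map_smul' c f := by
    ext z
    have hf := differentiableAt_extZero f z.2
    simp only [wirtinger, SetLike.val_smul, extZero_smul, fderiv_const_smul hf c,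
      smul_apply, Pi.smul_apply, RingHom.id_apply, smul_eq_mul]
    ring

/-- `∂_x`. -/
def Dx (U : Opens (ℂ × ℂ)) : Module.End ℂ (Smooth U) := partialD U (1, 0)

/-- `∂_y`. -/
def Dy (U : Opens (ℂ × ℂ)) : Module.End ℂ (Smooth U) := partialD U (0, 1)

/-- The coordinate function `x`. -/
def X (U : Opens (ℂ × ℂ)) : Smooth U :=
  ⟨fun z => z.1.1, by
    refine ContDiffOn.congr (contDiff_fst (𝕜 := ℝ) (E := ℂ) (F := ℂ)).contDiffOn fun z hz => ?_
    have hz' : z ∈ U := hz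
    simp [extZero_apply U _ hz']⟩

/-- The coordinate function `y`. -/
def Y (U : Opens (ℂ × ℂ)) : Smooth U :=
  ⟨fun z => z.1.2, by
    refine ContDiffOn.congr (contDiff_snd (𝕜 := ℝ) (E := ℂ) (F := ℂ)).contDiffOn fun z hz => ?_
    have hz' : z ∈ U := hz
    simp [extZero_apply U _ hz']⟩

/-- Multiplication by a smooth function, as an operator. -/
abbrev mulOp {U : Opens (ℂ × ℂ)} (f : Smooth U) : Module.End ℂ (Smooth U) :=
  LinearMap.mulLeft ℂ f

/-- The operator `∑ f_{ij} ∂_x^i ∂_y^j` with coefficients `f_{ij}`, all but finitely many zero. -/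
def toOp (U : Opens (ℂ × ℂ)) : (ℕ × ℕ →₀ Smooth U) →ₗ[ℂ] Module.End ℂ (Smooth U) :=
  Finsupp.lsum ℂ fun ij =>
    (LinearMap.mulRight ℂ (Dx U ^ ij.1 * Dy U ^ ij.2)).comp (LinearMap.mul ℂ (Smooth U))

/-- The operators `∑_{(i,j) ∈ A} f_{ij} ∂_x^i ∂_y^j` with smooth coefficients. -/
def opsOn (U : Opens (ℂ × ℂ)) (A : Set (ℕ × ℕ)) : Submodule ℂ (Module.End ℂ (Smooth U)) :=
  (Finsupp.supported (Smooth U) ℂ A).map (toOp U)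

/-- All differential operators on `U` with smooth coefficients. -/
def diffOps (U : Opens (ℂ × ℂ)) : Submodule ℂ (Module.End ℂ (Smooth U)) :=
  opsOn U Set.univ

/-- The differential operators of order at most `k`. -/
def opsOfOrderLE (U : Opens (ℂ × ℂ)) (k : ℕ) : Submodule ℂ (Module.End ℂ (Smooth U)) :=
  opsOn U {ij | ij.1 + ij.2 ≤ k}

/-- `T` is a differential operator with polynomial coefficients. -/
def IsPolyOp {U : Opens (ℂ × ℂ)} (T : Module.End ℂ (Smooth U)) : Prop :=
  ∃ f : ℕ × ℕ →₀ Smooth U, (∀ ij, f ij ∈ Algebra.adjoin ℂ {X U, Y U}) ∧ toOp U f = T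

/-- `T` has polynomial coefficients and bidegree `(a, b)`: it maps every monomial
`x^i y^j` to a multiple of `x^(i+a) y^(j+b)` (to zero if an exponent is negative). -/
def HasBidegree {U : Opens (ℂ × ℂ)} (T : Module.End ℂ (Smooth U)) (a b : ℤ) : Prop :=
  IsPolyOp T ∧ ∀ i j : ℕ, T (X U ^ i * Y U ^ j) ∈
    Submodule.span ℂ {u : Smooth U | ∃ m n : ℕ, (m : ℤ) = i + a ∧ (n : ℤ) = j + b ∧
      u = X U ^ m * Y U ^ n}

/-- The exponents of the staircase. -/
def stairs (r p q : ℕ) : Set (ℕ × ℕ) := {ij | ij.1 + r * ij.2 ≤ p ∧ ij.2 ≤ q}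

/-- The staircase module `S^r_{p,q}`, as a space of functions on `U`. -/
def stairModule (U : Opens (ℂ × ℂ)) (r p q : ℕ) : Submodule ℂ (Smooth U) :=
  Submodule.span ℂ ((fun ij : ℕ × ℕ => X U ^ ij.1 * Y U ^ ij.2) '' stairs r p q)

/-- The differential operators that preserve `S^r_{p,q}`. -/
def preserving (U : Opens (ℂ × ℂ)) (r p q : ℕ) : Submodule ℂ (Module.End ℂ (Smooth U)) where
  carrier := {T | T ∈ diffOps U ∧ ∀ u ∈ stairModule U r p q, T u ∈ stairModule U r p q}
  add_mem' h h' := ⟨add_mem h.1 h'.1, fun u hu => add_mem (h.2 u hu) (h'.2 u hu)⟩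
  zero_mem' := ⟨zero_mem _, fun _ _ => zero_mem _⟩
  smul_mem' c _ h :=
    ⟨Submodule.smul_mem _ c h.1, fun u hu => Submodule.smul_mem _ c (h.2 u hu)⟩

/-- The kernel of the restriction homomorphism from the operators preserving `S^r_{p,q}` to
`End S^r_{p,q}`. -/
def kerRestrict (U : Opens (ℂ × ℂ)) (r p q : ℕ) : Submodule ℂ (Module.End ℂ (Smooth U)) where
  carrier := {T | T ∈ preserving U r p q ∧ ∀ u ∈ stairModule U r p q, T u = 0}
  add_mem' h h' := ⟨add_mem h.1 h'.1, fun u hu => by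
    rw [LinearMap.add_apply, h.2 u hu, h'.2 u hu, add_zero]⟩
  zero_mem' := ⟨zero_mem _, fun _ _ => rfl⟩
  smul_mem' c _ h := ⟨Submodule.smul_mem _ c h.1, fun u hu => by
    rw [LinearMap.smul_apply, h.2 u hu, smul_zero]⟩

/-- The distinguished complement: operators preserving `S^r_{p,q}` of the form
`∑ f_{ij} ∂_x^i ∂_y^j` over `i + r j ≤ p`, `j ≤ q`. -/
def complement (U : Opens (ℂ × ℂ)) (r p q : ℕ) : Submodule ℂ (Module.End ℂ (Smooth U)) :=
  preserving U r p q ⊓ opsOn U (stairs r p q)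

/-- The operators in the distinguished complement with nonpositive `y`-degree, i.e. that are
sums of operators of bidegrees `(a, b)` with `b ≤ 0`. -/
def complementDown (U : Opens (ℂ × ℂ)) (r p q : ℕ) : Submodule ℂ (Module.End ℂ (Smooth U)) :=
  complement U r p q ⊓
    Submodule.span ℂ {T | ∃ a b : ℤ, b ≤ 0 ∧ HasBidegree T a b}

/-- The generators `J^1, …, J^{5+r}`, numbered from `0`:
`∂_x`, `x²∂_x + r x y ∂_y - p x`, `x∂_x - p/2`, `y∂_y`, and `x^i ∂_y` for `0 ≤ i ≤ r`. -/
def genAux (U : Opens (ℂ × ℂ)) (r p : ℕ) : ℕ → Module.End ℂ (Smooth U)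
  | 0 => Dx U
  | 1 => mulOp (X U ^ 2) * Dx U + (r : ℂ) • (mulOp (X U * Y U) * Dy U) - (p : ℂ) • mulOp (X U)
  | 2 => mulOp (X U) * Dx U - ((p : ℂ) / 2) • 1
  | 3 => mulOp (Y U) * Dy U
  | i + 4 => mulOp (X U ^ i) * Dy U

/-- The `r + 5` generators. -/
def gen (U : Opens (ℂ × ℂ)) (r p : ℕ) (s : Fin (r + 5)) : Module.End ℂ (Smooth U) :=
  genAux U r p s

/-- The value of a polynomial at the generators: each monomial is evaluated as the ordered
product `(J^1)^{K_1} (J^2)^{K_2} ⋯ (J^{5+r})^{K_{5+r}}`. -/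
def evalGen (U : Opens (ℂ × ℂ)) (r p : ℕ) (P : MvPolynomial (Fin (r + 5)) ℂ) :
    Module.End ℂ (Smooth U) :=
  ∑ K ∈ P.support, P.coeff K • (List.ofFn fun s => gen U r p s ^ K s).prod

/-- `T` is the projection of `P` onto the distinguished complement along the kernel. -/
def IsProjection (U : Opens (ℂ × ℂ)) (r p q : ℕ) (P T : Module.End ℂ (Smooth U)) : Prop :=
  P ∈ preserving U r p q ∧ T ∈ complement U r p q ∧ P - T ∈ kerRestrict U r p q

/-- `T` is a polynomial in the generators, of any degree and with the factors in any order, plus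
an operator in the kernel. -/
def IsLieAlgebraic (U : Opens (ℂ × ℂ)) (r p q : ℕ) (T : Module.End ℂ (Smooth U)) : Prop :=
  ∃ P ∈ Algebra.adjoin ℂ (Set.range (gen U r p)), ∃ N ∈ kerRestrict U r p q, T = P + N

end Staircase

end

noncomputable section

namespace Staircase

variable {U : Opens (ℂ × ℂ)}

/-! Everything rests on one triangularity: `∂_x^k ∂_y^l` kills `x^i y^j` unless `(k, l) ≤ (i, j)`.
The staircase is a lower set of exponents, so an operator with indices in it is determined by its
values on the staircase monomials, and truncating any operator to those indices leaves these values
unchanged (`opsOn_ext`, `exists_truncation`). This gives the splitting, and it reduces the claims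
about generators to comparing values on staircase monomials.

Positive direction. Only polynomial coefficients matter, so `T` splits into homogeneous components.
A component of bidegree `(a, -β)` multiplies `x^i y^j` by a polynomial symbol in `(i, j)`. That
symbol is divisible by the falling factorials of lengths `α = max(-a, 0)` in `i` and `β` in `j`,
which account for `∂_x^α` and for `β` factors `x^s ∂_y`. These factors raise the `x`-exponent by at
most `r β`. If `a` exceeds `r β` by `d > 0`, the component raises the weight `i + r j` by `d`, so
preservation of the staircase forces the symbol to vanish on the top `d` weight levels. The
generator `J^2` multiplies by `i + r j - p` while raising `i`, so `(J^2)^d` supplies a product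
vanishing on exactly those levels. `exists_factor` shows that on the staircase this product divides
the symbol without loss of degree. The quotient is a polynomial in the commuting diagonal operators
`J^3, J^4`. `exists_evalGen_of_shift` assembles the factors, and the degrees add up to at most the
order. For `k ≤ q`, `r k ≤ p` all indices of order at most `k` lie in the staircase, so agreement
there is equality.

Negative direction. No generator raises the degree in `y`, and kernel elements vanish on the
staircase, so an operator of the form polynomial plus kernel does not raise the `y`-degree of any
staircase monomial. Hence its homogeneous components of positive `y`-degree vanish there. -/

/-! ### Calculus of the complex partial derivatives -/

theorem extZero_mul (f g : U → ℂ) : extZero U (f * g) = extZero U f * extZero U g := by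
  funext z
  by_cases h : z ∈ U <;> simp [extZero, h]

theorem partialD_apply (v : ℂ × ℂ) (f : Smooth U) (z : U) :
    (partialD U v f : U → ℂ) z = wirtinger v (extZero U f) z := rfl

theorem partialD_mul (v : ℂ × ℂ) (f g : Smooth U) :
    partialD U v (f * g) = f * partialD U v g + g * partialD U v f := by
  ext z
  have hf := differentiableAt_extZero f z.2
  have hg := differentiableAt_extZero g z.2
  have hfz := extZero_apply U f z.2
  have hgz := extZero_apply U g z.2
  simp only [partialD_apply, MulMemClass.coe_mul, AddMemClass.coe_add, Pi.add_apply, Pi.mul_apply,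
    wirtinger, extZero_mul, fderiv_mul hf hg, add_apply, smul_apply, smul_eq_mul, hfz, hgz]
  ring

theorem wirtinger_congr {g h : ℂ × ℂ → ℂ} {z : ℂ × ℂ} (v : ℂ × ℂ) (hgh : g =ᶠ[nhds z] h) :
    wirtinger v g z = wirtinger v h z := by
  simp only [wirtinger, hgh.fderiv_eq]

theorem partialD_X (v : ℂ × ℂ) : partialD U v (X U) = algebraMap ℂ (Smooth U) v.1 := by
  ext z
  have h : extZero U (X U) =ᶠ[nhds (z : ℂ × ℂ)] (ContinuousLinearMap.fst ℝ ℂ ℂ) := by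
    filter_upwards [U.isOpen.mem_nhds z.2] with w hw
    exact extZero_apply U _ hw
  have : wirtinger v (extZero U (X U)) z = v.1 := by
    rw [wirtinger_congr v h, wirtinger, ContinuousLinearMap.fderiv]
    simp only [ContinuousLinearMap.coe_fst', Prod.smul_fst, smul_eq_mul]
    linear_combination (-(v.1) / 2) * Complex.I_mul_I
  exact this

theorem partialD_Y (v : ℂ × ℂ) : partialD U v (Y U) = algebraMap ℂ (Smooth U) v.2 := by
  ext z
  have h : extZero U (Y U) =ᶠ[nhds (z : ℂ × ℂ)] (ContinuousLinearMap.snd ℝ ℂ ℂ) := by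
    filter_upwards [U.isOpen.mem_nhds z.2] with w hw
    exact extZero_apply U _ hw
  have : wirtinger v (extZero U (Y U)) z = v.2 := by
    rw [wirtinger_congr v h, wirtinger, ContinuousLinearMap.fderiv]
    simp only [ContinuousLinearMap.coe_snd', Prod.smul_snd, smul_eq_mul]
    linear_combination (-(v.2) / 2) * Complex.I_mul_I
  exact this

/-- Both compositions expand into four values of the real second derivative, whose symmetry
exchanges them. -/
theorem partialD_commute (v w : ℂ × ℂ) : Commute (partialD U v) (partialD U w) := by
  have key : ∀ (v w : ℂ × ℂ) (f : Smooth U) (z : U), (partialD U v (partialD U w f) : U → ℂ) z =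
      (fderiv ℝ (fderiv ℝ (extZero U f)) z v w
        - Complex.I * fderiv ℝ (fderiv ℝ (extZero U f)) z v (Complex.I • w)
        - Complex.I * (fderiv ℝ (fderiv ℝ (extZero U f)) z (Complex.I • v) w
        - Complex.I * fderiv ℝ (fderiv ℝ (extZero U f)) z (Complex.I • v) (Complex.I • w))) / 4 := by
    intro v w f z
    have h : extZero U (partialD U w f) =ᶠ[nhds (z : ℂ × ℂ)] wirtinger w (extZero U f) := by
      filter_upwards [U.isOpen.mem_nhds z.2] with t ht
      exact extZero_apply U _ ht
    have hd : DifferentiableAt ℝ (fderiv ℝ (extZero U f)) z :=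
      ((ContDiffOn.fderiv_of_isOpen (m := ∞) f.2 U.isOpen (by simp)).contDiffAt
        (U.isOpen.mem_nhds z.2)).differentiableAt (by simp)
    have h1 : ∀ u : ℂ × ℂ, HasFDerivAt (fun t => fderiv ℝ (extZero U f) t u)
        ((fderiv ℝ (fderiv ℝ (extZero U f)) z).flip u) z := fun u => by
      simpa using hd.hasFDerivAt.clm_apply (hasFDerivAt_const u (z : ℂ × ℂ))
    have h2 : HasFDerivAt (wirtinger w (extZero U f))
        ((2 : ℂ)⁻¹ • ((fderiv ℝ (fderiv ℝ (extZero U f)) z).flip w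
          - Complex.I • (fderiv ℝ (fderiv ℝ (extZero U f)) z).flip (Complex.I • w))) z := by
      have := ((h1 w).sub ((h1 (Complex.I • w)).const_mul Complex.I)).const_mul (2 : ℂ)⁻¹
      refine this.congr_of_eventuallyEq (Filter.Eventually.of_forall fun t => ?_)
      simp only [wirtinger, div_eq_inv_mul, Pi.sub_apply]
    rw [partialD_apply, wirtinger_congr v h, wirtinger, h2.fderiv]
    simp only [smul_apply, sub_apply, ContinuousLinearMap.flip_apply, smul_eq_mul]
    ring
  ext f z
  have hs : IsSymmSndFDerivAt ℝ (extZero U f) z :=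
    ((f.2 : ContDiffOn ℝ ∞ (extZero U f) U).contDiffAt
      (U.isOpen.mem_nhds z.2)).isSymmSndFDerivAt
        (by
          rw [minSmoothness_of_isRCLikeNormedField]
          exact WithTop.coe_le_coe.2 (le_top : (2 : ℕ∞) ≤ ⊤))
  rw [Module.End.mul_apply, Module.End.mul_apply, key, key, hs.eq v w, hs.eq v (Complex.I • w),
    hs.eq (Complex.I • v) w, hs.eq (Complex.I • v) (Complex.I • w)]
  ring

/-- `partialD` as a derivation. -/
def partialDer (U : Opens (ℂ × ℂ)) (v : ℂ × ℂ) : Derivation ℂ (Smooth U) (Smooth U) :=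
  Derivation.mk' (partialD U v) fun f g => by simp [partialD_mul]

theorem partialDer_apply (v : ℂ × ℂ) (f : Smooth U) : partialDer U v f = partialD U v f := rfl

theorem Dx_mul_mulOp (f : Smooth U) : Dx U * mulOp f = mulOp f * Dx U + mulOp (Dx U f) := by
  ext1 g
  simp [Dx, partialD_mul, mul_comm]

theorem Dy_mul_mulOp (f : Smooth U) : Dy U * mulOp f = mulOp f * Dy U + mulOp (Dy U f) := by
  ext1 g
  simp [Dy, partialD_mul, mul_comm]

/-! ### Monomials and falling factorials -/

/-- The monomial `x^i y^j` on `U`. -/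
def mon (U : Opens (ℂ × ℂ)) (e : ℕ × ℕ) : Smooth U := X U ^ e.1 * Y U ^ e.2

theorem mon_mul_mon (e f : ℕ × ℕ) : mon U e * mon U f = mon U (e + f) := by
  simp only [mon, Prod.fst_add, Prod.snd_add, pow_add]
  ring

theorem Dx_mon (i j : ℕ) : Dx U (mon U (i, j)) = (i : ℂ) • mon U (i - 1, j) := by
  change partialDer U (1, 0) (X U ^ i * Y U ^ j) = _
  have hx : partialDer U (1, 0) (X U) = 1 := by
    rw [partialDer_apply, partialD_X]; simp
  have hy : partialDer U (1, 0) (Y U) = 0 := by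
    rw [partialDer_apply, partialD_Y]; simp
  rw [Derivation.leibniz, Derivation.leibniz_pow, Derivation.leibniz_pow, hx, hy]
  simp only [mon, smul_eq_mul, mul_one, nsmul_eq_mul]
  simp only [Algebra.smul_def, map_natCast]
  ring

theorem Dy_mon (i j : ℕ) : Dy U (mon U (i, j)) = (j : ℂ) • mon U (i, j - 1) := by
  change partialDer U (0, 1) (X U ^ i * Y U ^ j) = _
  have hx : partialDer U (0, 1) (X U) = 0 := by
    rw [partialDer_apply, partialD_X]; simp
  have hy : partialDer U (0, 1) (Y U) = 1 := by
    rw [partialDer_apply, partialD_Y]; simp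
  rw [Derivation.leibniz, Derivation.leibniz_pow, Derivation.leibniz_pow, hx, hy]
  simp only [mon, smul_eq_mul, mul_one, nsmul_eq_mul]
  simp only [Algebra.smul_def, map_natCast]
  ring

theorem Dx_pow_mon (k i j : ℕ) :
    (Dx U ^ k) (mon U (i, j)) = (i.descFactorial k : ℂ) • mon U (i - k, j) := by
  induction k with
  | zero => simp
  | succ k ih =>
    rw [pow_succ', Module.End.mul_apply, ih, map_smul, Dx_mon, smul_smul, Nat.descFactorial_succ,
      Nat.sub_sub]
    push_cast
    rw [mul_comm]

theorem Dy_pow_mon (k i j : ℕ) :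
    (Dy U ^ k) (mon U (i, j)) = (j.descFactorial k : ℂ) • mon U (i, j - k) := by
  induction k with
  | zero => simp
  | succ k ih =>
    rw [pow_succ', Module.End.mul_apply, ih, map_smul, Dy_mon, smul_smul, Nat.descFactorial_succ,
      Nat.sub_sub]
    push_cast
    rw [mul_comm]

/-- The operator `∂_x^k ∂_y^l`. -/
abbrev dd (U : Opens (ℂ × ℂ)) (k : ℕ × ℕ) : Module.End ℂ (Smooth U) := Dx U ^ k.1 * Dy U ^ k.2

/-- The eigenvalue-like factor of `∂_x^k ∂_y^l` on the monomial `x^i y^j`. -/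
def fall (k e : ℕ × ℕ) : ℂ := (e.1.descFactorial k.1 : ℂ) * (e.2.descFactorial k.2 : ℂ)

/-- The truncated subtraction is harmless: `fall k e` vanishes unless `k ≤ e`. -/
theorem dd_mon (k e : ℕ × ℕ) : dd U k (mon U e) = fall k e • mon U (e - k) := by
  obtain ⟨i, j⟩ := e
  obtain ⟨k, l⟩ := k
  simp only [dd, Module.End.mul_apply, Dy_pow_mon, map_smul, Dx_pow_mon, smul_smul, fall,
    Prod.mk_sub_mk]
  rw [mul_comm]

theorem fall_eq_zero {k e : ℕ × ℕ} (h : ¬ k ≤ e) : fall k e = 0 := by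
  rw [Prod.le_def, not_and_or, not_le, not_le] at h
  rcases h with h | h
  · simp [fall, Nat.descFactorial_eq_zero_iff_lt.2 h]
  · simp [fall, Nat.descFactorial_eq_zero_iff_lt.2 h]

theorem fall_ne_zero {k e : ℕ × ℕ} (h : k ≤ e) : fall k e ≠ 0 := by
  rw [Prod.le_def] at h
  simp only [fall, ne_eq, mul_eq_zero, Nat.cast_eq_zero, Nat.descFactorial_eq_zero_iff_lt, not_or,
    not_lt]
  exact h

/-- Differentiating a relation by a maximal exponent `e` of its support kills every other term and
leaves a nonzero constant, which can be evaluated because `U` has a point. -/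
theorem mon_linearIndependent (hU : (U : Set (ℂ × ℂ)).Nonempty) :
    LinearIndependent ℂ (mon U) := by
  obtain ⟨z, hz⟩ := hU
  rw [linearIndependent_iff]
  intro c hc
  by_contra hne
  obtain ⟨e, he⟩ := c.support.exists_maximal (Finsupp.support_nonempty_iff.2 hne)
  have h : dd U e (Finsupp.linearCombination ℂ (mon U) c) = (c e * fall e e) • 1 := by
    rw [Finsupp.linearCombination_apply, Finsupp.sum, map_sum, Finset.sum_eq_single e]
    · rw [map_smul, dd_mon, smul_smul]
      simp [mon]
    · intro f hf hfe
      rw [map_smul, dd_mon, fall_eq_zero, zero_smul, smul_zero]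
      exact fun hle => hfe (le_antisymm (he.2 hf hle) hle)
    · intro h
      simp [Finsupp.notMem_support_iff.1 h]
  rw [hc, map_zero] at h
  have h1 := congrFun (congrArg Subtype.val h) ⟨z, hz⟩
  have h2 : (0 : ℂ) = c e * fall e e := by simpa using h1
  exact mul_ne_zero (Finsupp.mem_support_iff.1 he.1) (fall_ne_zero le_rfl) h2.symm

/-- Coefficient extraction: a linear map sending each monomial to its exponent. -/
theorem exists_coeff (hU : (U : Set (ℂ × ℂ)).Nonempty) :
    ∃ L : Smooth U →ₗ[ℂ] (ℕ × ℕ →₀ ℂ), ∀ e, L (mon U e) = Finsupp.single e 1 := by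
  obtain ⟨L, hL⟩ := LinearMap.exists_leftInverse_of_injective
    (Finsupp.linearCombination ℂ (mon U)) (LinearMap.ker_eq_bot.2 (mon_linearIndependent hU))
  refine ⟨L, fun e => ?_⟩
  have := LinearMap.congr_fun hL (Finsupp.single e 1)
  simpa using this

theorem mem_adjoin_iff (f : Smooth U) :
    f ∈ Algebra.adjoin ℂ {X U, Y U} ↔ f ∈ Submodule.span ℂ (Set.range (mon U)) := by
  constructor
  · intro h
    induction h using Algebra.adjoin_induction with
    | mem f hf =>
      rcases hf with rfl | rfl
      · exact Submodule.subset_span ⟨(1, 0), by simp [mon]⟩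
      · exact Submodule.subset_span ⟨(0, 1), by simp [mon]⟩
    | algebraMap c =>
      rw [Algebra.algebraMap_eq_smul_one]
      exact Submodule.smul_mem _ _ (Submodule.subset_span ⟨(0, 0), by simp [mon]⟩)
    | add f g _ _ hf hg => exact add_mem hf hg
    | mul f g _ _ hf hg =>
      have := Submodule.mul_mem_mul hf hg
      rw [Submodule.span_mul_span] at this
      refine Submodule.span_mono ?_ this
      rintro _ ⟨_, ⟨e, rfl⟩, _, ⟨e', rfl⟩, rfl⟩
      exact ⟨e + e', (mon_mul_mon e e').symm⟩
  · intro h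
    refine (Submodule.span_le (p := Subalgebra.toSubmodule (Algebra.adjoin ℂ {X U, Y U}))).2 ?_ h
    rintro _ ⟨e, rfl⟩
    refine Subalgebra.mul_mem _ (pow_mem (Algebra.subset_adjoin (by simp)) _)
      (pow_mem (Algebra.subset_adjoin (by simp)) _)

/-! ### Triangularity and truncation of differential operators -/

theorem end_sub_eq (A B : Module.End ℂ (Smooth U)) : A - B = A + (-1 : ℂ) • B := by
  ext u z
  rw [LinearMap.sub_apply]
  simp [sub_eq_add_neg]

theorem end_sub_mem {N : Submodule ℂ (Module.End ℂ (Smooth U))} {A B : Module.End ℂ (Smooth U)}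
    (hA : A ∈ N) (hB : B ∈ N) : A - B ∈ N := by
  rw [end_sub_eq]
  exact N.add_mem hA (N.smul_mem _ hB)

theorem toOp_apply (f : ℕ × ℕ →₀ Smooth U) (u : Smooth U) :
    toOp U f u = f.sum fun k c => c * dd U k u := by
  rw [toOp, Finsupp.lsum_apply, Finsupp.sum, LinearMap.sum_apply]
  rfl

theorem toOp_single (k : ℕ × ℕ) (c : Smooth U) :
    toOp U (Finsupp.single k c) = mulOp c * dd U k := by
  rw [toOp, Finsupp.lsum_single]
  rfl

theorem mem_opsOn {A : Set (ℕ × ℕ)} {T : Module.End ℂ (Smooth U)} :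
    T ∈ opsOn U A ↔ ∃ f : ℕ × ℕ →₀ Smooth U, (∀ k ∉ A, f k = 0) ∧ toOp U f = T := by
  simp only [opsOn, Submodule.mem_map, Finsupp.mem_supported']

theorem opsOn_mono {A B : Set (ℕ × ℕ)} (h : A ⊆ B) : opsOn U A ≤ opsOn U B :=
  Submodule.map_mono (Finsupp.supported_mono h)

theorem mulOp_mul_dd_mem {A : Set (ℕ × ℕ)} {k : ℕ × ℕ} (hk : k ∈ A) (c : Smooth U) :
    mulOp c * dd U k ∈ opsOn U A := by
  classical
  refine mem_opsOn.2 ⟨Finsupp.single k c, fun l hl => ?_, toOp_single k c⟩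
  rw [Finsupp.single_apply, if_neg]
  rintro rfl
  exact hl hk

theorem opsOn_induction {A : Set (ℕ × ℕ)} {N : Submodule ℂ (Module.End ℂ (Smooth U))}
    (h : ∀ k ∈ A, ∀ c : Smooth U, mulOp c * dd U k ∈ N) : opsOn U A ≤ N := by
  intro T hT
  obtain ⟨f, hf, rfl⟩ := mem_opsOn.1 hT
  rw [← Finsupp.sum_single f, Finsupp.sum, map_sum]
  refine sum_mem fun k hk => ?_
  rw [toOp_single]
  refine h k ?_ _
  by_contra hkA
  exact Finsupp.mem_support_iff.1 hk (hf k hkA)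

theorem toOp_mon (f : ℕ × ℕ →₀ Smooth U) (e : ℕ × ℕ) :
    toOp U f (mon U e) = f.sum fun k c => fall k e • (c * mon U (e - k)) := by
  rw [toOp_apply]
  refine Finsupp.sum_congr fun k _ => ?_
  rw [dd_mon, mul_smul_comm]

/-- Triangularity: the coefficients of an operator indexed by a lower set of exponents are
determined by its values on the monomials of that lower set. -/
theorem coeff_mem_of_toOp_mem {A : Set (ℕ × ℕ)} (hA : IsLowerSet A) (N : Submodule ℂ (Smooth U))
    (hN : ∀ u ∈ N, ∀ e, u * mon U e ∈ N) (f : ℕ × ℕ →₀ Smooth U)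
    (h : ∀ e ∈ A, toOp U f (mon U e) ∈ N) : ∀ e ∈ A, f e ∈ N := by
  intro e
  induction e using WellFoundedLT.induction with
  | ind e ih =>
    intro he
    have h1 := h e he
    rw [toOp_mon, Finsupp.sum_of_support_subset f (Finset.subset_insert e _) _ (by simp),
      ← Finset.add_sum_erase _ _ (Finset.mem_insert_self e _)] at h1
    -- Only indices strictly below `e` act nontrivially on `x^e`; their coefficients lie in `N` by
    -- induction.
    have h2 : ∑ k ∈ (insert e f.support).erase e, fall k e • (f k * mon U (e - k)) ∈ N := by
      refine sum_mem fun k hk => ?_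
      by_cases hke : k ≤ e
      · exact N.smul_mem _ (hN _ (ih k (lt_of_le_of_ne hke (Finset.ne_of_mem_erase hk))
          (hA hke he)) _)
      · rw [fall_eq_zero hke, zero_smul]
        exact zero_mem _
    have h3 : fall e e • (f e * mon U (e - e)) ∈ N := (add_mem_cancel_right h2).1 h1
    rw [N.smul_mem_iff (fall_ne_zero le_rfl)] at h3
    simpa [mon] using h3

theorem toOp_filter_mon {A : Set (ℕ × ℕ)} [DecidablePred (· ∈ A)] (hA : IsLowerSet A)
    (f : ℕ × ℕ →₀ Smooth U) {e : ℕ × ℕ} (he : e ∈ A) :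
    toOp U (f.filter (· ∈ A)) (mon U e) = toOp U f (mon U e) := by
  rw [toOp_mon, toOp_mon, Finsupp.sum_filter_index, Finsupp.sum]
  refine Finset.sum_subset (Finset.filter_subset _ _) fun k hk hk' => ?_
  have : k ∉ A := fun h => hk' (by simpa [h] using hk)
  rw [fall_eq_zero fun hle => this (hA hle he), zero_smul]

/-- Triangularity with `N = ⊥`, applied to the difference. -/
theorem opsOn_ext {A : Set (ℕ × ℕ)} (hA : IsLowerSet A) {T T' : Module.End ℂ (Smooth U)}
    (hT : T ∈ opsOn U A) (hT' : T' ∈ opsOn U A) (h : ∀ e ∈ A, T (mon U e) = T' (mon U e)) :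
    T = T' := by
  refine sub_eq_zero.1 ?_
  obtain ⟨f, hf, hfT⟩ := mem_opsOn.1 (end_sub_mem hT hT')
  have h0 := coeff_mem_of_toOp_mem hA ⊥ (by simp) f (fun e he => by simp [hfT, h e he])
  have : f = 0 := by
    ext1 e
    by_cases he : e ∈ A
    · exact h0 e he
    · exact hf e he
  rw [← hfT, this, map_zero]

/-- An operator can be truncated to a lower set of exponents without changing it there. -/
theorem exists_truncation {A B : Set (ℕ × ℕ)} (hA : IsLowerSet A) {T : Module.End ℂ (Smooth U)}
    (hT : T ∈ opsOn U B) :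
    ∃ T' ∈ opsOn U (A ∩ B), ∀ e ∈ A, T' (mon U e) = T (mon U e) := by
  classical
  obtain ⟨f, hf, rfl⟩ := mem_opsOn.1 hT
  refine ⟨toOp U (f.filter (· ∈ A)), mem_opsOn.2 ⟨_, fun k hk => ?_, rfl⟩,
    fun e he => toOp_filter_mon hA f he⟩
  rw [Finsupp.filter_apply]
  split_ifs with h
  · exact hf k fun hB => hk ⟨h, hB⟩
  · rfl

/-! ### The staircase and the splitting of its preserving operators -/

theorem stairs_isLowerSet (r p q : ℕ) : IsLowerSet (stairs r p q) := by
  rintro ⟨i, j⟩ ⟨i', j'⟩ h ⟨h1, h2⟩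
  obtain ⟨hi, hj⟩ := Prod.mk_le_mk.1 h
  exact ⟨(add_le_add hi (Nat.mul_le_mul_left r hj)).trans h1, hj.trans h2⟩

theorem mon_mem_stairModule {r p q : ℕ} {e : ℕ × ℕ} (he : e ∈ stairs r p q) :
    mon U e ∈ stairModule U r p q :=
  Submodule.subset_span ⟨e, he, rfl⟩

theorem apply_mem_of_mem_stairModule {r p q : ℕ} {T : Module.End ℂ (Smooth U)}
    {N : Submodule ℂ (Smooth U)} (h : ∀ e ∈ stairs r p q, T (mon U e) ∈ N) :
    ∀ u ∈ stairModule U r p q, T u ∈ N := by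
  intro u hu
  have : stairModule U r p q ≤ N.comap T := Submodule.span_le.2 (by
    rintro _ ⟨e, he, rfl⟩
    exact h e he)
  exact this hu

theorem eq_on_stairModule {r p q : ℕ} {T T' : Module.End ℂ (Smooth U)}
    (h : ∀ e ∈ stairs r p q, T (mon U e) = T' (mon U e)) :
    ∀ u ∈ stairModule U r p q, T u = T' u := by
  intro u hu
  have := apply_mem_of_mem_stairModule (T := T - T') (N := ⊥)
    (fun e he => by simp [h e he]) u hu
  simpa [sub_eq_zero] using this

theorem mem_kerRestrict {r p q : ℕ} {T : Module.End ℂ (Smooth U)} (hT : T ∈ diffOps U)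
    (h : ∀ e ∈ stairs r p q, T (mon U e) = 0) : T ∈ kerRestrict U r p q := by
  have h0 := eq_on_stairModule (T' := 0) h
  exact ⟨⟨hT, fun u hu => by rw [h0 u hu]; exact zero_mem _⟩, h0⟩

theorem mem_preserving {r p q : ℕ} {T : Module.End ℂ (Smooth U)} (hT : T ∈ diffOps U)
    (h : ∀ e ∈ stairs r p q, T (mon U e) ∈ stairModule U r p q) : T ∈ preserving U r p q :=
  ⟨hT, apply_mem_of_mem_stairModule h⟩

theorem disjoint_complement_kerRestrict (U : Opens (ℂ × ℂ)) (r p q : ℕ) :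
    Disjoint (complement U r p q) (kerRestrict U r p q) := by
  rw [Submodule.disjoint_def]
  intro T hT hT'
  exact opsOn_ext (stairs_isLowerSet r p q) hT.2 (zero_mem _)
    fun e he => hT'.2 _ (mon_mem_stairModule he)

/-- The truncation to the staircase is the component in the complement; what was cut off annihilates
the staircase monomials. -/
theorem complement_sup_kerRestrict (U : Opens (ℂ × ℂ)) (r p q : ℕ) :
    complement U r p q ⊔ kerRestrict U r p q = preserving U r p q := by
  refine le_antisymm (sup_le inf_le_left fun T hT => hT.1) fun T hT => ?_
  obtain ⟨T', hT', h⟩ := exists_truncation (stairs_isLowerSet r p q) hT.1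
  rw [Set.inter_univ] at hT'
  have hT'd : T' ∈ diffOps U := opsOn_mono (Set.subset_univ _) hT'
  have hadd : T = T' + (T - T') := by abel
  rw [hadd]
  refine Submodule.add_mem_sup ⟨mem_preserving hT'd fun e he => ?_, hT'⟩
    (mem_kerRestrict (end_sub_mem hT.1 hT'd) fun e he => by simp [h e he])
  rw [h e he]
  exact hT.2 _ (mon_mem_stairModule he)

/-! ### The order filtration -/

theorem opsOfOrderLE_le_diffOps (k : ℕ) : opsOfOrderLE U k ≤ diffOps U :=
  opsOn_mono (Set.subset_univ _)

theorem opsOfOrderLE_mono {k l : ℕ} (h : k ≤ l) : opsOfOrderLE U k ≤ opsOfOrderLE U l :=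
  opsOn_mono fun _ hk => le_trans hk h

theorem mulOp_mul_mem_opsOfOrderLE {k : ℕ} {T : Module.End ℂ (Smooth U)}
    (hT : T ∈ opsOfOrderLE U k) (c : Smooth U) : mulOp c * T ∈ opsOfOrderLE U k := by
  have : opsOfOrderLE U k ≤ (opsOfOrderLE U k).comap (LinearMap.mulLeft ℂ (mulOp c)) := by
    refine opsOn_induction fun e he f => ?_
    have : mulOp c * (mulOp f * dd U e) = mulOp (c * f) * dd U e := by
      ext1 u
      simp
    simp only [Submodule.mem_comap, LinearMap.mulLeft_apply]
    rw [this]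
    exact mulOp_mul_dd_mem he _
  exact this hT

theorem Dx_mul_mem_opsOfOrderLE {k : ℕ} {T : Module.End ℂ (Smooth U)}
    (hT : T ∈ opsOfOrderLE U k) : Dx U * T ∈ opsOfOrderLE U (k + 1) := by
  have : opsOfOrderLE U k ≤ (opsOfOrderLE U (k + 1)).comap (LinearMap.mulLeft ℂ (Dx U)) := by
    refine opsOn_induction fun e he f => ?_
    have : Dx U * (mulOp f * dd U e) = mulOp f * dd U (e.1 + 1, e.2) + mulOp (Dx U f) * dd U e := by
      rw [← mul_assoc, Dx_mul_mulOp, add_mul, mul_assoc, ← mul_assoc (Dx U), ← pow_succ']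
    simp only [Submodule.mem_comap, LinearMap.mulLeft_apply]
    rw [this]
    have he' : e.1 + e.2 ≤ k := he
    exact add_mem (mulOp_mul_dd_mem (show e.1 + 1 + e.2 ≤ k + 1 by omega) _)
      (mulOp_mul_dd_mem (show e.1 + e.2 ≤ k + 1 by omega) _)
  exact this hT

theorem Dy_mul_mem_opsOfOrderLE {k : ℕ} {T : Module.End ℂ (Smooth U)}
    (hT : T ∈ opsOfOrderLE U k) : Dy U * T ∈ opsOfOrderLE U (k + 1) := by
  have : opsOfOrderLE U k ≤ (opsOfOrderLE U (k + 1)).comap (LinearMap.mulLeft ℂ (Dy U)) := by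
    refine opsOn_induction fun e he f => ?_
    have : Dy U * (mulOp f * dd U e) = mulOp f * dd U (e.1, e.2 + 1) + mulOp (Dy U f) * dd U e := by
      have hc : Dy U * Dx U ^ e.1 = Dx U ^ e.1 * Dy U := (partialD_commute _ _).pow_right _
      rw [← mul_assoc, Dy_mul_mulOp, add_mul, mul_assoc, ← mul_assoc (Dy U), hc, mul_assoc,
        ← pow_succ']
    simp only [Submodule.mem_comap, LinearMap.mulLeft_apply]
    rw [this]
    have he' : e.1 + e.2 ≤ k := he
    exact add_mem (mulOp_mul_dd_mem (show e.1 + (e.2 + 1) ≤ k + 1 by omega) _)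
      (mulOp_mul_dd_mem (show e.1 + e.2 ≤ k + 1 by omega) _)
  exact this hT

theorem one_mem_opsOfOrderLE (k : ℕ) : (1 : Module.End ℂ (Smooth U)) ∈ opsOfOrderLE U k := by
  have := mulOp_mul_dd_mem (U := U) (show ((0, 0) : ℕ × ℕ) ∈ {e : ℕ × ℕ | e.1 + e.2 ≤ k} by simp) 1
  have h1 : (1 : Module.End ℂ (Smooth U)) = mulOp 1 * dd U (0, 0) := by
    refine LinearMap.ext fun u => ?_
    simp
  rw [h1]
  exact this

theorem gen_mul_mem_opsOfOrderLE {r p k : ℕ} (s : Fin (r + 5)) {T : Module.End ℂ (Smooth U)}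
    (hT : T ∈ opsOfOrderLE U k) : gen U r p s * T ∈ opsOfOrderLE U (k + 1) := by
  have hx := fun c => mulOp_mul_mem_opsOfOrderLE (Dx_mul_mem_opsOfOrderLE hT) c
  have hy := fun c => mulOp_mul_mem_opsOfOrderLE (Dy_mul_mem_opsOfOrderLE hT) c
  have h1 := opsOfOrderLE_mono (Nat.le_succ k) hT
  obtain ⟨s, hs⟩ := s
  change genAux U r p s * T ∈ _
  clear hs
  match s with
  | 0 => exact Dx_mul_mem_opsOfOrderLE hT
  | 1 =>
    rw [genAux, end_sub_eq, add_mul, add_mul, smul_mul_assoc, smul_mul_assoc, smul_mul_assoc,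
      mul_assoc, mul_assoc]
    exact Submodule.add_mem _ (Submodule.add_mem _ (hx _) (Submodule.smul_mem _ _ (hy _)))
      (Submodule.smul_mem _ _ (Submodule.smul_mem _ _ (mulOp_mul_mem_opsOfOrderLE h1 _)))
  | 2 =>
    rw [genAux, end_sub_eq, add_mul, smul_mul_assoc, smul_mul_assoc, mul_assoc, one_mul]
    exact Submodule.add_mem _ (hx _) (Submodule.smul_mem _ _ (Submodule.smul_mem _ _ h1))
  | 3 =>
    rw [genAux, mul_assoc]
    exact hy _
  | i + 4 =>
    rw [genAux, mul_assoc]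
    exact hy _

theorem gen_pow_mul_mem_opsOfOrderLE {r p k : ℕ} (s : Fin (r + 5)) (n : ℕ)
    {T : Module.End ℂ (Smooth U)} (hT : T ∈ opsOfOrderLE U k) :
    gen U r p s ^ n * T ∈ opsOfOrderLE U (n + k) := by
  induction n with
  | zero =>
    rw [pow_zero, one_mul, zero_add]
    exact hT
  | succ n ih =>
    rw [pow_succ', mul_assoc, add_right_comm]
    exact gen_mul_mem_opsOfOrderLE s ih

/-- The arbitrary selection `g` of generators lets the induction pass to the tail of the list. -/
theorem ofFn_prod_mem_opsOfOrderLE {r p : ℕ} (n : ℕ) (g : Fin n → Fin (r + 5)) (K : Fin n → ℕ) :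
    (List.ofFn fun s => gen U r p (g s) ^ K s).prod ∈ opsOfOrderLE U (∑ s, K s) := by
  induction n with
  | zero => exact one_mem_opsOfOrderLE _
  | succ n ih =>
    rw [List.ofFn_succ, List.prod_cons, Fin.sum_univ_succ]
    exact gen_pow_mul_mem_opsOfOrderLE _ _ (ih (fun s => g s.succ) fun s => K s.succ)

theorem evalGen_mem_opsOfOrderLE (r p : ℕ) (P : MvPolynomial (Fin (r + 5)) ℂ) :
    evalGen U r p P ∈ opsOfOrderLE U P.totalDegree := by
  refine sum_mem fun K hK => Submodule.smul_mem _ _ ?_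
  refine opsOfOrderLE_mono ?_ (ofFn_prod_mem_opsOfOrderLE (r + 5) id K)
  have := MvPolynomial.le_totalDegree hK
  rwa [Finsupp.sum_fintype _ _ (by simp)] at this

/-! ### Linearity of the ordered evaluation -/

theorem evalGen_eq_sum {r p : ℕ} {P : MvPolynomial (Fin (r + 5)) ℂ}
    {s : Finset (Fin (r + 5) →₀ ℕ)} (hs : P.support ⊆ s) :
    evalGen U r p P = ∑ K ∈ s, P.coeff K • (List.ofFn fun t => gen U r p t ^ K t).prod :=
  Finset.sum_subset hs fun K _ hK => by rw [MvPolynomial.notMem_support_iff.1 hK, zero_smul]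

theorem evalGen_add (r p : ℕ) (P Q : MvPolynomial (Fin (r + 5)) ℂ) :
    evalGen U r p (P + Q) = evalGen U r p P + evalGen U r p Q := by
  classical
  rw [evalGen_eq_sum MvPolynomial.support_add,
    evalGen_eq_sum (P := P) Finset.subset_union_left,
    evalGen_eq_sum (P := Q) Finset.subset_union_right, ← Finset.sum_add_distrib]
  exact Finset.sum_congr rfl fun K _ => by rw [MvPolynomial.coeff_add, add_smul]

theorem evalGen_zero (r p : ℕ) : evalGen U r p 0 = 0 := by
  simp [evalGen]

theorem evalGen_sum (r p : ℕ) {ι : Type*} (s : Finset ι) (P : ι → MvPolynomial (Fin (r + 5)) ℂ) :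
    evalGen U r p (∑ i ∈ s, P i) = ∑ i ∈ s, evalGen U r p (P i) := by
  classical
  induction s using Finset.induction_on with
  | empty => simp [evalGen_zero]
  | insert i s hi ih => rw [Finset.sum_insert hi, Finset.sum_insert hi, evalGen_add, ih]

theorem evalGen_monomial (r p : ℕ) (K : Fin (r + 5) →₀ ℕ) (c : ℂ) :
    evalGen U r p (MvPolynomial.monomial K c) =
      c • (List.ofFn fun t => gen U r p t ^ K t).prod := by
  classical
  rw [evalGen_eq_sum MvPolynomial.support_monomial_subset, Finset.sum_singleton,
    MvPolynomial.coeff_monomial, if_pos rfl]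

/-! ### Homogeneous components and their symbols -/

theorem coeff_eq_zero {L : Smooth U →ₗ[ℂ] (ℕ × ℕ →₀ ℂ)}
    (hL : ∀ e, L (mon U e) = Finsupp.single e 1) {S : Set (ℕ × ℕ)} {u : Smooth U}
    (hu : u ∈ Submodule.span ℂ (mon U '' S)) {m : ℕ × ℕ} (hm : m ∉ S) : L u m = 0 := by
  have : Submodule.span ℂ (mon U '' S) ≤ LinearMap.ker ((Finsupp.lapply m).comp L) := by
    refine Submodule.span_le.2 ?_
    rintro _ ⟨e, he, rfl⟩
    have hne : e ≠ m := fun h => hm (h ▸ he)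
    simp [hL, hne]
  exact this hu

/-- The operator `∑ G(k, m) x^m ∂^k` in multi-index notation. -/
def opOf (U : Opens (ℂ × ℂ)) :
    ((ℕ × ℕ) × (ℕ × ℕ) →₀ ℂ) →ₗ[ℂ] Module.End ℂ (Smooth U) :=
  Finsupp.linearCombination ℂ fun t => mulOp (mon U t.2) * dd U t.1

/-- The bidegree of `x^m ∂^k`. -/
def shift (t : (ℕ × ℕ) × (ℕ × ℕ)) : ℤ × ℤ :=
  ((t.2.1 : ℤ) - t.1.1, (t.2.2 : ℤ) - t.1.2)

/-- The function of the exponent by which a homogeneous operator multiplies monomials. -/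
def symb (G : (ℕ × ℕ) × (ℕ × ℕ) →₀ ℂ) (e : ℕ × ℕ) : ℂ := G.sum fun t c => c * fall t.1 e

theorem opOf_mem_opsOn {B : Set (ℕ × ℕ)} {G : (ℕ × ℕ) × (ℕ × ℕ) →₀ ℂ}
    (hG : ∀ t ∈ G.support, t.1 ∈ B) : opOf U G ∈ opsOn U B :=
  Submodule.sum_mem _ fun t ht => Submodule.smul_mem _ _ (mulOp_mul_dd_mem (hG t ht) _)

theorem mulOp_mul_dd_mem_range {B : Set (ℕ × ℕ)} {k : ℕ × ℕ} (hk : k ∈ B) {c : Smooth U}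
    (hc : c ∈ Submodule.span ℂ (Set.range (mon U))) :
    mulOp c * dd U k ∈ Submodule.span ℂ
      ((fun t : (ℕ × ℕ) × (ℕ × ℕ) => mulOp (mon U t.2) * dd U t.1) '' {t | t.1 ∈ B}) := by
  have : Submodule.span ℂ (Set.range (mon U)) ≤ (Submodule.span ℂ
      ((fun t : (ℕ × ℕ) × (ℕ × ℕ) => mulOp (mon U t.2) * dd U t.1) '' {t | t.1 ∈ B})).comap
      ((toOp U).comp (Finsupp.lsingle k)) := by
    refine Submodule.span_le.2 ?_
    rintro _ ⟨m, rfl⟩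
    refine Submodule.subset_span ⟨(k, m), hk, ?_⟩
    exact (toOp_single k _).symm
  have h := this hc
  rw [Submodule.mem_comap, LinearMap.comp_apply, Finsupp.lsingle_apply, toOp_single] at h
  exact h

/-- Triangularity with `N` the space of polynomials: polynomial values on the monomials of `A` force
polynomial coefficients at the indices in `A`. Truncation keeps the indices in `B`, hence the order
bound. -/
theorem exists_opOf {A B : Set (ℕ × ℕ)} (hA : IsLowerSet A) {T : Module.End ℂ (Smooth U)}
    (hT : T ∈ opsOn U B) (h : ∀ e ∈ A, T (mon U e) ∈ Submodule.span ℂ (Set.range (mon U))) :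
    ∃ G : (ℕ × ℕ) × (ℕ × ℕ) →₀ ℂ, (∀ t ∈ G.support, t.1 ∈ A ∩ B) ∧
      ∀ e ∈ A, opOf U G (mon U e) = T (mon U e) := by
  obtain ⟨T', hT', hTT'⟩ := exists_truncation hA hT
  obtain ⟨f, hf, rfl⟩ := mem_opsOn.1 hT'
  have hpoly := coeff_mem_of_toOp_mem hA (Submodule.span ℂ (Set.range (mon U)))
    (fun u hu e => by
      rw [← mem_adjoin_iff] at hu ⊢
      exact Subalgebra.mul_mem _ hu
        ((mem_adjoin_iff _).2 (Submodule.subset_span (Set.mem_range_self e)))) f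
    (fun e he => by rw [hTT' e he]; exact h e he)
  have hmem : toOp U f ∈ Submodule.span ℂ
      ((fun t : (ℕ × ℕ) × (ℕ × ℕ) => mulOp (mon U t.2) * dd U t.1) '' {t | t.1 ∈ A ∩ B}) := by
    rw [← Finsupp.sum_single f, Finsupp.sum, map_sum]
    refine Submodule.sum_mem _ fun k hk => ?_
    rw [toOp_single]
    have hkA : k ∈ A ∩ B := by
      by_contra hkA
      exact Finsupp.mem_support_iff.1 hk (hf k hkA)
    exact mulOp_mul_dd_mem_range hkA (hpoly k hkA.1)
  obtain ⟨G, hG, hGT⟩ := (Finsupp.mem_span_image_iff_linearCombination ℂ).1 hmem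
  refine ⟨G, fun t ht => hG ht, fun e he => ?_⟩
  rw [opOf, hGT, hTT' e he]

theorem opOf_eq_sum_filter (G : (ℕ × ℕ) × (ℕ × ℕ) →₀ ℂ) :
    opOf U G = ∑ d ∈ G.support.image shift, opOf U (G.filter (shift · = d)) := by
  classical
  simp only [opOf, Finsupp.linearCombination_apply, Finsupp.sum_filter_index, Finsupp.support_filter]
  exact (Finset.sum_fiberwise_of_maps_to (fun t ht => Finset.mem_image_of_mem shift ht) _).symm

theorem opOf_mon (G : (ℕ × ℕ) × (ℕ × ℕ) →₀ ℂ) (e : ℕ × ℕ) :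
    opOf U G (mon U e) = G.sum fun t c => (c * fall t.1 e) • mon U (t.2 + (e - t.1)) := by
  rw [opOf, Finsupp.linearCombination_apply, Finsupp.sum, LinearMap.sum_apply]
  refine Finset.sum_congr rfl fun t _ => ?_
  rw [LinearMap.smul_apply, Module.End.mul_apply, dd_mon, map_smul, LinearMap.mulLeft_apply,
    mon_mul_mon, smul_smul]

theorem add_sub_eq_iff_shift {t : (ℕ × ℕ) × (ℕ × ℕ)} {e m : ℕ × ℕ} {d : ℤ × ℤ} (h : t.1 ≤ e)
    (h1 : (m.1 : ℤ) = e.1 + d.1) (h2 : (m.2 : ℤ) = e.2 + d.2) :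
    t.2 + (e - t.1) = m ↔ shift t = d := by
  rw [Prod.le_def] at h
  simp only [Prod.ext_iff, shift, Prod.fst_add, Prod.snd_add, Prod.fst_sub, Prod.snd_sub]
  omega

/-- Different bidegrees send `x^e` to different monomials, so a coefficient of the image sees a
single component. Constraints on the image of the whole operator thus become constraints on each
symbol. -/
theorem coeff_opOf_mon {L : Smooth U →ₗ[ℂ] (ℕ × ℕ →₀ ℂ)}
    (hL : ∀ e, L (mon U e) = Finsupp.single e 1) (G : (ℕ × ℕ) × (ℕ × ℕ) →₀ ℂ) {e m : ℕ × ℕ}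
    {d : ℤ × ℤ} (h1 : (m.1 : ℤ) = e.1 + d.1) (h2 : (m.2 : ℤ) = e.2 + d.2) :
    L (opOf U G (mon U e)) m = symb (G.filter (shift · = d)) e := by
  classical
  rw [opOf_mon, Finsupp.sum, map_sum, Finsupp.finsetSum_apply, symb, Finsupp.sum_filter_index,
    Finsupp.support_filter, Finset.sum_filter]
  refine Finset.sum_congr rfl fun t _ => ?_
  rw [map_smul, hL, Finsupp.smul_apply, Finsupp.single_apply]
  by_cases h : t.1 ≤ e
  · simp only [add_sub_eq_iff_shift h h1 h2]
    split_ifs <;> simp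
  · simp [fall_eq_zero h]

/-- A term with `k ≤ e` maps `x^e` to a monomial with nonnegative exponents. This makes the `toNat`
in `opOf_mon_of_shift` harmless. -/
theorem symb_eq_zero_of_neg {G : (ℕ × ℕ) × (ℕ × ℕ) →₀ ℂ} {d : ℤ × ℤ}
    (hG : ∀ t ∈ G.support, shift t = d) {e : ℕ × ℕ}
    (h : (e.1 : ℤ) + d.1 < 0 ∨ (e.2 : ℤ) + d.2 < 0) : symb G e = 0 := by
  refine Finset.sum_eq_zero fun t ht => ?_
  have := hG t ht
  dsimp only
  rw [fall_eq_zero, mul_zero]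
  rw [Prod.le_def]
  simp only [Prod.ext_iff, shift] at this
  omega

theorem opOf_mon_of_shift {G : (ℕ × ℕ) × (ℕ × ℕ) →₀ ℂ} {d : ℤ × ℤ}
    (hG : ∀ t ∈ G.support, shift t = d) (e : ℕ × ℕ) :
    opOf U G (mon U e) =
      symb G e • mon U (((e.1 : ℤ) + d.1).toNat, ((e.2 : ℤ) + d.2).toNat) := by
  rw [opOf_mon, symb, Finsupp.sum, Finsupp.sum, Finset.sum_smul]
  refine Finset.sum_congr rfl fun t ht => ?_
  by_cases h : t.1 ≤ e
  · have hs := hG t ht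
    rw [Prod.le_def] at h
    simp only [Prod.ext_iff, shift] at hs
    congr 2
    ext <;> simp <;> omega
  · simp [fall_eq_zero h]

theorem isPolyOp_opOf (G : (ℕ × ℕ) × (ℕ × ℕ) →₀ ℂ) : IsPolyOp (opOf U G) := by
  classical
  refine ⟨∑ t ∈ G.support, Finsupp.single t.1 (G t • mon U t.2), fun k => ?_, ?_⟩
  · rw [Finsupp.finsetSum_apply]
    refine Subalgebra.sum_mem _ fun t _ => ?_
    rw [Finsupp.single_apply]
    split_ifs
    · exact Subalgebra.smul_mem _
        ((mem_adjoin_iff _).2 (Submodule.subset_span (Set.mem_range_self _))) _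
    · exact Subalgebra.zero_mem _
  · rw [map_sum, opOf, Finsupp.linearCombination_apply, Finsupp.sum]
    refine Finset.sum_congr rfl fun t _ => ?_
    rw [toOp_single]
    refine LinearMap.ext fun u => ?_
    simp

theorem hasBidegree_opOf {G : (ℕ × ℕ) × (ℕ × ℕ) →₀ ℂ} {d : ℤ × ℤ}
    (hG : ∀ t ∈ G.support, shift t = d) : HasBidegree (opOf U G) d.1 d.2 := by
  refine ⟨isPolyOp_opOf G, fun i j => ?_⟩
  change opOf U G (mon U (i, j)) ∈ _
  rw [opOf_mon_of_shift hG]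
  by_cases h : ((i : ℤ) + d.1 < 0 ∨ (j : ℤ) + d.2 < 0)
  · rw [symb_eq_zero_of_neg (e := (i, j)) hG h, zero_smul]
    exact Submodule.zero_mem _
  · refine Submodule.smul_mem _ _ (Submodule.subset_span ⟨_, _, ?_, ?_, rfl⟩) <;> dsimp only <;> omega

/-! ### The filtration by degree in `y`, and operators outside the Lie-algebraic part -/

/-- Polynomials of degree at most `j` in `y`. -/
def yLE (U : Opens (ℂ × ℂ)) (j : ℕ) : Submodule ℂ (Smooth U) :=
  Submodule.span ℂ (mon U '' {m | m.2 ≤ j})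

theorem mon_mem_yLE {e : ℕ × ℕ} {j : ℕ} (h : e.2 ≤ j) : mon U e ∈ yLE U j :=
  Submodule.subset_span ⟨e, h, rfl⟩

theorem apply_mon_mem_yLE {T : Module.End ℂ (Smooth U)}
    (hT : T ∈ Submodule.span ℂ {T : Module.End ℂ (Smooth U) | ∃ a b : ℤ, b ≤ 0 ∧ HasBidegree T a b}) (e : ℕ × ℕ) :
    T (mon U e) ∈ yLE U e.2 := by
  have : Submodule.span ℂ {T : Module.End ℂ (Smooth U) | ∃ a b : ℤ, b ≤ 0 ∧ HasBidegree T a b} ≤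
      (yLE U e.2).comap (LinearMap.applyₗ (R := ℂ) (M := Smooth U) (M₂ := Smooth U) (mon U e)) := by
    refine Submodule.span_le.2 ?_
    rintro T ⟨a, b, hb, -, h⟩
    change T (mon U e) ∈ yLE U e.2
    refine (Submodule.span_le (p := yLE U e.2)).2 ?_ (h e.1 e.2)
    rintro _ ⟨m, n, -, hn, rfl⟩
    exact mon_mem_yLE (e := (m, n)) (show n ≤ e.2 by omega)
  exact this hT

theorem stairModule_le_span (r p q : ℕ) :
    stairModule U r p q ≤ Submodule.span ℂ (Set.range (mon U)) :=
  Submodule.span_mono (Set.image_subset_range _ _)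

/-- A criterion for membership by values on the staircase alone: a component of positive `y`-degree
has zero symbol there, hence is the zero operator, since its indices also lie in the staircase. -/
theorem mem_complementDown (hU : (U : Set (ℂ × ℂ)).Nonempty) {r p q : ℕ}
    {T : Module.End ℂ (Smooth U)} (hT : T ∈ complement U r p q)
    (h : ∀ e ∈ stairs r p q, T (mon U e) ∈ yLE U e.2) : T ∈ complementDown U r p q := by
  classical
  refine ⟨hT, ?_⟩
  obtain ⟨L, hL⟩ := exists_coeff hU
  have hA := stairs_isLowerSet r p q
  obtain ⟨G, hG, hGT⟩ := exists_opOf hA hT.2 fun e he =>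
    stairModule_le_span r p q (hT.1.2 _ (mon_mem_stairModule he))
  have hTG : T = opOf U G := opsOn_ext hA hT.2 (opOf_mem_opsOn fun t ht => (hG t ht).1)
    fun e he => (hGT e he).symm
  rw [hTG, opOf_eq_sum_filter]
  refine Submodule.sum_mem _ fun d _ => ?_
  have hd : ∀ t ∈ (G.filter (shift · = d)).support, shift t = d := fun t ht => by
    rw [Finsupp.support_filter, Finset.mem_filter] at ht
    exact ht.2
  by_cases hd0 : d.2 ≤ 0
  · exact Submodule.subset_span ⟨_, _, hd0, hasBidegree_opOf hd⟩
  · have h0 : opOf U (G.filter (shift · = d)) = 0 := by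
      refine opsOn_ext hA (opOf_mem_opsOn fun t ht => ?_) (Submodule.zero_mem _) fun e he => ?_
      · rw [Finsupp.support_filter, Finset.mem_filter] at ht
        exact (hG t ht.1).1
      · rw [opOf_mon_of_shift hd, LinearMap.zero_apply]
        by_cases hneg : (e.1 : ℤ) + d.1 < 0 ∨ (e.2 : ℤ) + d.2 < 0
        · rw [symb_eq_zero_of_neg hd hneg, zero_smul]
        · rw [← coeff_opOf_mon (U := U) hL G
            (m := (((e.1 : ℤ) + d.1).toNat, ((e.2 : ℤ) + d.2).toNat))
            (by dsimp only; omega) (by dsimp only; omega), ← hTG,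
            coeff_eq_zero hL (h e he) (by simp only [Set.mem_ofPred_eq]; omega), zero_smul]
    rw [h0]
    exact Submodule.zero_mem _

theorem Dx_mem_yLE {j : ℕ} {u : Smooth U} (hu : u ∈ yLE U j) : Dx U u ∈ yLE U j := by
  have : yLE U j ≤ (yLE U j).comap (Dx U) := by
    refine Submodule.span_le.2 ?_
    rintro _ ⟨⟨m, n⟩, h, rfl⟩
    rw [SetLike.mem_coe, Submodule.mem_comap, Dx_mon]
    exact Submodule.smul_mem _ _ (mon_mem_yLE h)
  exact this hu

theorem mulOp_mul_Dy_mon_mem_yLE {j : ℕ} {u : Smooth U} (hu : u ∈ yLE U j) {m : ℕ × ℕ}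
    (hm : m.2 ≤ 1) : mon U m * Dy U u ∈ yLE U j := by
  have : yLE U j ≤ (yLE U j).comap (mulOp (mon U m) * Dy U) := by
    refine Submodule.span_le.2 ?_
    rintro _ ⟨⟨k, n⟩, h, rfl⟩
    rw [SetLike.mem_coe, Submodule.mem_comap, Module.End.mul_apply, Dy_mon, map_smul,
      LinearMap.mulLeft_apply, mon_mul_mon]
    have hn : n ≤ j := h
    rcases Nat.eq_zero_or_pos n with rfl | hpos
    · simp
    · exact Submodule.smul_mem _ _ (mon_mem_yLE (by simp only [Prod.snd_add]; omega))
  exact this hu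

theorem mon_mul_mem_yLE {j : ℕ} {u : Smooth U} (hu : u ∈ yLE U j) (i : ℕ) :
    mon U (i, 0) * u ∈ yLE U j := by
  have : yLE U j ≤ (yLE U j).comap (mulOp (mon U (i, 0))) := by
    refine Submodule.span_le.2 ?_
    rintro _ ⟨⟨k, n⟩, h, rfl⟩
    rw [SetLike.mem_coe, Submodule.mem_comap, LinearMap.mulLeft_apply, mon_mul_mon]
    exact mon_mem_yLE (by simpa using h)
  exact this hu

theorem genAux_mem_yLE (r p s j : ℕ) {u : Smooth U} (hu : u ∈ yLE U j) :
    genAux U r p s u ∈ yLE U j := by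
  have hX : ∀ i, mon U (i, 0) = X U ^ i := fun i => by simp [mon]
  have hx1 : mon U (1, 0) = X U := by simp [mon]
  have hy1 : mon U (0, 1) = Y U := by simp [mon]
  have hxy : mon U (1, 1) = X U * Y U := by simp [mon]
  match s with
  | 0 => exact Dx_mem_yLE hu
  | 1 =>
    have h : genAux U r p 1 u = mon U (2, 0) * Dx U u + (r : ℂ) • (mon U (1, 1) * Dy U u)
      - (p : ℂ) • (mon U (1, 0) * u) := by rw [hX, hxy, hx1]; rfl
    rw [h]
    exact sub_mem (add_mem (mon_mul_mem_yLE (Dx_mem_yLE hu) _)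
      (Submodule.smul_mem _ _ (mulOp_mul_Dy_mon_mem_yLE hu le_rfl)))
      (Submodule.smul_mem _ _ (mon_mul_mem_yLE hu _))
  | 2 =>
    have h : genAux U r p 2 u = mon U (1, 0) * Dx U u - ((p : ℂ) / 2) • u := by rw [hx1]; rfl
    rw [h]
    exact sub_mem (mon_mul_mem_yLE (Dx_mem_yLE hu) _) (Submodule.smul_mem _ _ hu)
  | 3 =>
    have h : genAux U r p 3 u = mon U (0, 1) * Dy U u := by rw [hy1]; rfl
    rw [h]
    exact mulOp_mul_Dy_mon_mem_yLE hu le_rfl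
  | i + 4 =>
    have h : genAux U r p (i + 4) u = mon U (i, 0) * Dy U u := by rw [hX]; rfl
    rw [h]
    exact mulOp_mul_Dy_mon_mem_yLE hu (Nat.zero_le _)

/-- The operators preserving every `yLE U j` are closed under sums and products, so neither the
degree nor the order of factors matters. -/
theorem adjoin_gen_mem_yLE {r p : ℕ} {P : Module.End ℂ (Smooth U)}
    (hP : P ∈ Algebra.adjoin ℂ (Set.range (gen U r p))) :
    ∀ j : ℕ, ∀ u ∈ yLE U j, P u ∈ yLE U j := by
  induction hP using Algebra.adjoin_induction with
  | mem P hP =>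
    obtain ⟨s, rfl⟩ := hP
    exact fun j u hu => genAux_mem_yLE r p s j hu
  | algebraMap c =>
    intro j u hu
    rw [Module.algebraMap_end_apply]
    exact Submodule.smul_mem _ _ hu
  | add P Q _ _ hP hQ => exact fun j u hu => add_mem (hP j u hu) (hQ j u hu)
  | mul P Q _ _ hP hQ => exact fun j u hu => hP j _ (hQ j u hu)

theorem IsLieAlgebraic.apply_mon_mem_yLE {r p q : ℕ} {T : Module.End ℂ (Smooth U)}
    (hT : IsLieAlgebraic U r p q T) {e : ℕ × ℕ} (he : e ∈ stairs r p q) :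
    T (mon U e) ∈ yLE U e.2 := by
  obtain ⟨P, hP, N, hN, rfl⟩ := hT
  rw [LinearMap.add_apply, hN.2 _ (mon_mem_stairModule he), add_zero]
  exact adjoin_gen_mem_yLE hP _ _ (mon_mem_yLE le_rfl)

theorem not_isLieAlgebraic_of_hasBidegree (hU : (U : Set (ℂ × ℂ)).Nonempty) {r p q : ℕ}
    {T : Module.End ℂ (Smooth U)} (hT : T ∈ complement U r p q) (hT0 : T ≠ 0) {a b : ℤ}
    (hb : 0 < b) (h : HasBidegree T a b) : ¬ IsLieAlgebraic U r p q T := by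
  intro hLie
  obtain ⟨L, hL⟩ := exists_coeff hU
  refine hT0 (opsOn_ext (stairs_isLowerSet r p q) hT.2 (Submodule.zero_mem _) fun e he => ?_)
  have h1 := hLie.apply_mon_mem_yLE he
  rw [LinearMap.zero_apply]
  by_cases hneg : (e.1 : ℤ) + a < 0
  · have h2 := h.2 e.1 e.2
    have hempty : {u : Smooth U | ∃ m n : ℕ, (m : ℤ) = e.1 + a ∧ (n : ℤ) = e.2 + b ∧
      u = X U ^ m * Y U ^ n} = ∅ := by
      refine Set.eq_empty_of_forall_notMem ?_
      rintro u ⟨m, n, hm, -⟩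
      omega
    rw [hempty, Submodule.span_empty] at h2
    exact h2
  · have h2 : T (mon U e) ∈ Submodule.span ℂ
        {mon U (((e.1 : ℤ) + a).toNat, ((e.2 : ℤ) + b).toNat)} := by
      refine Submodule.span_mono ?_ (h.2 e.1 e.2)
      rintro u ⟨m, n, hm, hn, rfl⟩
      rw [← hm, ← hn]
      rfl
    obtain ⟨c, hc⟩ := Submodule.mem_span_singleton.1 h2
    -- The only monomial that can occur in the image has `y`-exponent `e.2 + b > e.2`, which `h1`
    -- excludes.
    have h3 := coeff_eq_zero hL h1 (m := (((e.1 : ℤ) + a).toNat, ((e.2 : ℤ) + b).toNat))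
      (by simp only [Set.mem_ofPred_eq]; omega)
    rw [← hc, map_smul, hL] at h3
    have hc0 : c = 0 := by simpa using h3
    rw [← hc, hc0, zero_smul]

theorem not_isLieAlgebraic_of_notMem (hU : (U : Set (ℂ × ℂ)).Nonempty) {r p q : ℕ}
    {T : Module.End ℂ (Smooth U)} (hT : T ∈ complement U r p q)
    (h : T ∉ complementDown U r p q) : ¬ IsLieAlgebraic U r p q T :=
  fun hLie => h (mem_complementDown hU hT fun _ he => hLie.apply_mon_mem_yLE he)

/-! ### The example `y ∂_x²` -/

theorem dd_fst (k : ℕ) : dd U (k, 0) = Dx U ^ k := by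
  rw [dd, pow_zero, mul_one]

theorem hasBidegree_Y_mul_Dx_sq : HasBidegree (mulOp (Y U) * Dx U ^ 2) (-2) 1 := by
  have h : mulOp (Y U) * Dx U ^ 2 = opOf U (Finsupp.single ((2, 0), (0, 1)) 1) := by
    rw [opOf, Finsupp.linearCombination_single, one_smul, dd_fst]
    simp [mon]
  rw [h]
  refine hasBidegree_opOf (d := (-2, 1)) fun t ht => ?_
  rw [Finsupp.mem_support_single] at ht
  rw [ht.1]
  simp [shift]

theorem Y_mul_Dx_sq_mon (i j : ℕ) : (mulOp (Y U) * Dx U ^ 2) (mon U (i, j)) =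
    (i.descFactorial 2 : ℂ) • mon U (i - 2, j + 1) := by
  rw [Module.End.mul_apply, Dx_pow_mon, map_smul, LinearMap.mulLeft_apply]
  congr 1
  simp only [mon]
  ring

theorem Y_mul_Dx_sq_mem_complement {p : ℕ} (hp : 2 ≤ p) :
    mulOp (Y U) * Dx U ^ 2 ∈ complement U 2 p (p / 2) := by
  have h : mulOp (Y U) * Dx U ^ 2 ∈ opsOn U (stairs 2 p (p / 2)) := by
    have := mulOp_mul_dd_mem (U := U) (k := (2, 0)) (A := stairs 2 p (p / 2))
      ⟨by simpa using hp, Nat.zero_le _⟩ (Y U)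
    rwa [dd_fst] at this
  refine ⟨mem_preserving (opsOn_mono (Set.subset_univ _) h) ?_, h⟩
  rintro ⟨i, j⟩ ⟨h1, h2⟩
  rw [Y_mul_Dx_sq_mon]
  dsimp only at h1 h2
  rcases lt_or_ge i 2 with hi | hi
  · rw [Nat.descFactorial_eq_zero_iff_lt.2 hi, Nat.cast_zero, zero_smul]
    exact Submodule.zero_mem _
  · exact Submodule.smul_mem _ _ (mon_mem_stairModule ⟨by dsimp only; omega, by dsimp only; omega⟩)

theorem Y_mul_Dx_sq_ne_zero (hU : (U : Set (ℂ × ℂ)).Nonempty) :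
    mulOp (Y U) * Dx U ^ 2 ≠ 0 := by
  intro h
  have h1 := Y_mul_Dx_sq_mon (U := U) 2 0
  rw [h, LinearMap.zero_apply, eq_comm, smul_eq_zero] at h1
  rcases h1 with h1 | h1
  · simp [Nat.descFactorial] at h1
  · exact (mon_linearIndependent hU).ne_zero _ h1

/-! ### Divisibility of symbols by rising factorials on the staircase -/

/-- The rising factorial `u (u + 1) ⋯ (u + t - 1)`. -/
def rise (u : ℂ) (t : ℕ) : ℂ := ∏ s ∈ Finset.range t, (u + s)

theorem rise_succ (u : ℂ) (t : ℕ) : rise u (t + 1) = rise u t * (u + t) :=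
  Finset.prod_range_succ _ _

theorem rise_add (u : ℂ) (t s : ℕ) :
    rise u (t + s) = rise u t * ∏ x ∈ Finset.range s, (u + (t + x : ℕ)) :=
  Finset.prod_range_add _ _ _

theorem rise_neg_eq_zero {t s : ℕ} (h : t < s) : rise (-(t : ℂ)) s = 0 :=
  Finset.prod_eq_zero (Finset.mem_range.2 h) (by simp)

theorem rise_neg_ne_zero {t s : ℕ} (h : s ≤ t) : rise (-(t : ℂ)) s ≠ 0 := by
  refine Finset.prod_ne_zero_iff.2 fun x hx => ?_
  rw [Finset.mem_range] at hx
  rw [neg_add_eq_sub, sub_ne_zero, Ne, Nat.cast_inj]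
  omega

theorem cast_descFactorial_succ (n k : ℕ) :
    (n.descFactorial (k + 1) : ℂ) = (n - k) * n.descFactorial k := by
  rw [Nat.descFactorial_succ]
  rcases le_or_gt k n with h | h
  · rw [Nat.cast_mul, Nat.cast_sub h]
  · simp [Nat.descFactorial_eq_zero_iff_lt.2 h]

theorem cast_descFactorial_eq_prod (n k : ℕ) :
    (n.descFactorial k : ℂ) = ∏ s ∈ Finset.range k, ((n : ℂ) - s) := by
  induction k with
  | zero => simp
  | succ k ih => rw [cast_descFactorial_succ, Finset.prod_range_succ, ih, mul_comm]

theorem descFactorial_add_cast (n k l : ℕ) :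
    (n.descFactorial (k + l) : ℂ) = n.descFactorial k * (n - k).descFactorial l := by
  induction l with
  | zero => simp
  | succ l ih =>
    rw [← add_assoc, Nat.descFactorial_succ, Nat.descFactorial_succ, Nat.cast_mul, ih, Nat.sub_sub]
    push_cast
    ring

/-- Extracts the falling factorial common to all terms of a homogeneous symbol. -/
theorem fall_eq_mul {k₀ k : ℕ × ℕ} (h : k₀ ≤ k) (e : ℕ × ℕ) :
    fall k e = fall k₀ e * fall (k - k₀) (e - k₀) := by
  obtain ⟨k', rfl⟩ := exists_add_of_le h
  rw [add_tsub_cancel_left]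
  simp only [fall, Prod.fst_add, Prod.snd_add, descFactorial_add_cast, Prod.fst_sub, Prod.snd_sub]
  ring

/-- Products of a rising factorial of `i + r j - p` and a falling factorial of `j`. -/
def adapted (r p : ℕ) (x e : ℕ × ℕ) : ℂ :=
  rise ((e.1 : ℂ) + r * e.2 - p) x.1 * (e.2.descFactorial x.2 : ℂ)

/-- Polynomial functions of degree at most `K` in the basis `adapted`. -/
def adaptedLE (r p K : ℕ) : Submodule ℂ (ℕ × ℕ → ℂ) :=
  Submodule.span ℂ (adapted r p '' {x | x.1 + x.2 ≤ K})

theorem adapted_mem {r p K : ℕ} {x : ℕ × ℕ} (h : x.1 + x.2 ≤ K) :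
    adapted r p x ∈ adaptedLE r p K :=
  Submodule.subset_span ⟨x, h, rfl⟩

theorem adaptedLE_mono {r p K K' : ℕ} (h : K ≤ K') : adaptedLE r p K ≤ adaptedLE r p K' :=
  Submodule.span_mono (Set.image_mono fun _ hx => le_trans hx h)

theorem fst_mul_mem_adaptedLE {r p K : ℕ} {φ : ℕ × ℕ → ℂ} (h : φ ∈ adaptedLE r p K) :
    (fun e : ℕ × ℕ => (e.1 : ℂ)) * φ ∈ adaptedLE r p (K + 1) := by
  have : adaptedLE r p K ≤ (adaptedLE r p (K + 1)).comap
      (LinearMap.mulLeft ℂ (fun e : ℕ × ℕ => (e.1 : ℂ))) := by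
    refine Submodule.span_le.2 ?_
    rintro _ ⟨⟨t, l⟩, hx, rfl⟩
    have hx' : t + l ≤ K := hx
    -- With `u = i + r j - p`, write `i = (u + t) + (p - t - r l) - r (j - l)`; the factors `u + t`
    -- and `j - l` lengthen the two factorials.
    have key : (fun e : ℕ × ℕ => (e.1 : ℂ)) * adapted r p (t, l) =
        adapted r p (t + 1, l) + ((p : ℂ) - t - r * l) • adapted r p (t, l)
          - (r : ℂ) • adapted r p (t, l + 1) := by
      funext e
      simp only [Pi.mul_apply, Pi.add_apply, Pi.sub_apply, Pi.smul_apply, smul_eq_mul, adapted,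
        rise_succ, cast_descFactorial_succ]
      ring
    rw [SetLike.mem_coe, Submodule.mem_comap, LinearMap.mulLeft_apply, key]
    exact sub_mem (add_mem (adapted_mem (by dsimp only; omega))
      (Submodule.smul_mem _ _ (adapted_mem (by dsimp only; omega))))
      (Submodule.smul_mem _ _ (adapted_mem (by dsimp only; omega)))
  exact this h

theorem fall_mem_adaptedLE (r p : ℕ) (k : ℕ × ℕ) : fall k ∈ adaptedLE r p (k.1 + k.2) := by
  obtain ⟨k, l⟩ := k
  induction k with
  | zero =>
    have : fall (0, l) = adapted r p (0, l) := by
      funext e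
      simp [fall, adapted, rise]
    rw [this]
    exact adapted_mem le_rfl
  | succ k ih =>
    have : fall (k + 1, l) = (fun e : ℕ × ℕ => (e.1 : ℂ)) * fall (k, l) - (k : ℂ) • fall (k, l) := by
      funext e
      simp only [fall, cast_descFactorial_succ, Pi.mul_apply, Pi.sub_apply, Pi.smul_apply,
        smul_eq_mul]
      ring
    rw [this]
    have h1 := fst_mul_mem_adaptedLE ih
    dsimp only at h1 ih ⊢
    rw [add_right_comm]
    exact sub_mem h1 (Submodule.smul_mem _ _ (adaptedLE_mono (Nat.le_succ _) ih))

/-- The adapted basis is triangular too: at the staircase point with `u = -x.1` and `j = x.2`, the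
function with index `y` vanishes unless `y ≤ x`, and the one with index `x` does not vanish. For
`x.1 < d` this point lies on the top `d` levels, so the coefficients vanish one after another. -/
theorem coeff_adapted_eq_zero {r p q d : ℕ} (E : ℕ × ℕ →₀ ℂ)
    (h : ∀ e ∈ stairs r p q, p < e.1 + r * e.2 + d →
      (E.sum fun x c => c * adapted r p x e) = 0) :
    ∀ x : ℕ × ℕ, x.1 < d → x.1 + r * x.2 ≤ p → x.2 ≤ q → E x = 0 := by
  intro x
  induction x using WellFoundedLT.induction with
  | ind x ih =>
    intro h1 h2 h3
    have h0 := h (p - (x.1 + r * x.2), x.2) ⟨by dsimp only; omega, h3⟩ (by dsimp only; omega)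
    have hu : ((p - (x.1 + r * x.2) : ℕ) : ℂ) + r * x.2 - p = -(x.1 : ℂ) := by
      rw [Nat.cast_sub h2]
      push_cast
      ring
    rw [Finsupp.sum, Finset.sum_eq_single x] at h0
    · simp only [adapted, hu] at h0
      refine (mul_eq_zero.1 h0).resolve_right (mul_ne_zero (rise_neg_ne_zero le_rfl) ?_)
      rw [Nat.cast_ne_zero, Ne, Nat.descFactorial_eq_zero_iff_lt]
      omega
    · intro y _ hy
      simp only [adapted, hu]
      rcases lt_or_ge x.1 y.1 with hy1 | hy1
      · rw [rise_neg_eq_zero hy1, zero_mul, mul_zero]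
      rcases lt_or_ge x.2 y.2 with hy2 | hy2
      · rw [Nat.descFactorial_eq_zero_iff_lt.2 hy2, Nat.cast_zero, mul_zero, mul_zero]
      have := Nat.mul_le_mul_left r hy2
      rw [ih y (lt_of_le_of_ne (Prod.le_def.2 ⟨hy1, hy2⟩) hy) (by omega) (by omega) (by omega),
        zero_mul]
    · intro hx
      rw [Finsupp.notMem_support_iff.1 hx, zero_mul]

open MvPolynomial in
/-- The polynomial with values `(u + d) ⋯ (u + t - 1) j (j - 1) ⋯ (j - l + 1)`, where
`u = i + r j - p`, at `(i + c, j)`. -/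
def adaptedPoly (r p d : ℕ) (c : ℂ) (x : ℕ × ℕ) : MvPolynomial (Fin 2) ℂ :=
  (∏ s ∈ Finset.range (x.1 - d),
      (MvPolynomial.X 0 + C (r : ℂ) * MvPolynomial.X 1 + C ((d + s : ℕ) - c - p))) *
    ∏ s ∈ Finset.range x.2, (MvPolynomial.X 1 + C (-(s : ℂ)))

open MvPolynomial in
theorem totalDegree_adaptedPoly_le (r p d : ℕ) (c : ℂ) (x : ℕ × ℕ) :
    (adaptedPoly r p d c x).totalDegree ≤ (x.1 - d) + x.2 := by
  have h1 : ∀ a b : ℂ, (MvPolynomial.X 0 + C a * MvPolynomial.X 1 + C b :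
      MvPolynomial (Fin 2) ℂ).totalDegree ≤ 1 := fun a b => by
    refine (totalDegree_add _ _).trans (max_le ((totalDegree_add _ _).trans (max_le ?_ ?_)) ?_)
    · rw [totalDegree_X]
    · refine (totalDegree_mul _ _).trans ?_
      rw [totalDegree_C, totalDegree_X]
    · simp
  have h2 : ∀ b : ℂ, (MvPolynomial.X 1 + C b : MvPolynomial (Fin 2) ℂ).totalDegree ≤ 1 :=
    fun b => by
      refine (totalDegree_add _ _).trans (max_le ?_ ?_)
      · rw [totalDegree_X]
      · simp
  refine (totalDegree_mul _ _).trans (add_le_add ?_ ?_)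
  · refine (totalDegree_finsetProd _ _).trans ((Finset.sum_le_card_nsmul _ _ 1 fun s _ =>
      h1 _ _).trans ?_)
    simp
  · refine (totalDegree_finsetProd _ _).trans ((Finset.sum_le_card_nsmul _ _ 1 fun s _ =>
      h2 _).trans ?_)
    simp

theorem rise_mul_eval_adaptedPoly (r p d : ℕ) (c : ℂ) {x : ℕ × ℕ} (hx : d ≤ x.1) (e : ℕ × ℕ) :
    rise ((e.1 : ℂ) + r * e.2 - p) d *
      MvPolynomial.eval ![(e.1 : ℂ) + c, (e.2 : ℂ)] (adaptedPoly r p d c x) = adapted r p x e := by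
  obtain ⟨n, hn⟩ := Nat.exists_eq_add_of_le hx
  rw [adapted, hn, rise_add, mul_assoc, cast_descFactorial_eq_prod, adaptedPoly, map_mul, map_prod,
    map_prod, hn, Nat.add_sub_cancel_left]
  congr 2
  · refine Finset.prod_congr rfl fun s _ => ?_
    simp
    ring
  · refine Finset.prod_congr rfl fun s _ => ?_
    simp
    ring

/-- A polynomial function of degree at most `K` that vanishes at the points of the staircase with
`i + r j > p - d` agrees on the staircase with a multiple of
`(i + r j - p) (i + r j - p + 1) ⋯ (i + r j - p + d - 1)` of degree at most `K`. -/
theorem exists_factor {r p q d K : ℕ} {φ : ℕ × ℕ → ℂ} (hφ : φ ∈ adaptedLE r p K)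
    (h : ∀ e ∈ stairs r p q, p < e.1 + r * e.2 + d → φ e = 0) (c : ℂ) :
    ∃ ψ : MvPolynomial (Fin 2) ℂ, (ψ = 0 ∨ ψ.totalDegree + d ≤ K) ∧
      ∀ e ∈ stairs r p q, φ e = rise ((e.1 : ℂ) + r * e.2 - p) d *
        MvPolynomial.eval ![(e.1 : ℂ) + c, (e.2 : ℂ)] ψ := by
  classical
  obtain ⟨E, hE, rfl⟩ := (Finsupp.mem_span_image_iff_linearCombination ℂ).1 hφ
  have hval : ∀ e, Finsupp.linearCombination ℂ (adapted r p) E e =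
      E.sum fun x c => c * adapted r p x e := fun e => by
    rw [Finsupp.linearCombination_apply, Finsupp.sum, Finset.sum_apply]
    rfl
  simp only [hval] at h ⊢
  have h0 := coeff_adapted_eq_zero E h
  -- The terms with `x.1 ≥ d` contain the required factor; dividing it out lowers each degree by
  -- `d`. The shift `c` only changes the variable of `ψ`.
  refine ⟨∑ x ∈ E.support.filter (d ≤ ·.1), E x • adaptedPoly r p d c x, ?_, fun e he => ?_⟩
  · by_cases hdK : d ≤ K
    · right
      have : (∑ x ∈ E.support.filter (d ≤ ·.1), E x • adaptedPoly r p d c x).totalDegree ≤ K - d := by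
        refine MvPolynomial.totalDegree_finsetSum_le fun x hx => ?_
        refine (MvPolynomial.totalDegree_smul_le _ _).trans
          ((totalDegree_adaptedPoly_le r p d c x).trans ?_)
        rw [Finset.mem_filter] at hx
        have hxK : x.1 + x.2 ≤ K := hE hx.1
        omega
      omega
    · left
      rw [Finset.filter_eq_empty_iff.2, Finset.sum_empty]
      intro x hx
      have hxK : x.1 + x.2 ≤ K := hE hx
      omega
  · rw [map_sum, Finset.mul_sum, Finset.sum_filter, Finsupp.sum]
    refine Finset.sum_congr rfl fun x hx => ?_
    split_ifs with hxd
    · rw [MvPolynomial.smul_eval, mul_left_comm, rise_mul_eval_adaptedPoly r p d c hxd]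
    -- A term with `x.1 < d` vanishes on the staircase: if both its factorials are nonzero at `e`,
    -- then `x` itself lies in the staircase, and its coefficient is zero.
    · have he1 : e.1 + r * e.2 ≤ p := he.1
      have hu : (e.1 : ℂ) + r * e.2 - p = -((p - (e.1 + r * e.2) : ℕ) : ℂ) := by
        rw [Nat.cast_sub he1]
        push_cast
        ring
      rw [adapted, hu]
      rcases lt_or_ge (p - (e.1 + r * e.2)) x.1 with hx1 | hx1
      · rw [rise_neg_eq_zero hx1, zero_mul, mul_zero]
      rcases lt_or_ge e.2 x.2 with hx2 | hx2
      · rw [Nat.descFactorial_eq_zero_iff_lt.2 hx2, Nat.cast_zero, mul_zero, mul_zero]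
      have := Nat.mul_le_mul_left r hx2
      rw [h0 x (by omega) (by omega) (hx2.trans he.2), zero_mul]

/-! ### Action of the generators on monomials -/

theorem gen_one_mon (r p i j : ℕ) : genAux U r p 1 (mon U (i, j)) =
    ((i : ℂ) + r * j - p) • mon U (i + 1, j) := by
  have h : genAux U r p 1 (mon U (i, j)) = X U ^ 2 * Dx U (mon U (i, j))
      + (r : ℂ) • (X U * Y U * Dy U (mon U (i, j))) - (p : ℂ) • (X U * mon U (i, j)) := rfl
  have hx : X U ^ 2 * Dx U (mon U (i, j)) = (i : ℂ) • mon U (i + 1, j) := by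
    rw [Dx_mon, mul_smul_comm]
    rcases Nat.eq_zero_or_pos i with rfl | hi
    · simp
    · obtain ⟨i, rfl⟩ := Nat.exists_eq_add_of_le' hi
      congr 1
      simp only [mon, Nat.add_sub_cancel]
      ring
  have hy : X U * Y U * Dy U (mon U (i, j)) = (j : ℂ) • mon U (i + 1, j) := by
    rw [Dy_mon, mul_smul_comm]
    rcases Nat.eq_zero_or_pos j with rfl | hj
    · simp
    · obtain ⟨j, rfl⟩ := Nat.exists_eq_add_of_le' hj
      congr 1
      simp only [mon, Nat.add_sub_cancel]
      ring
  have h1 : X U * mon U (i, j) = mon U (i + 1, j) := by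
    simp only [mon]
    ring
  rw [h, hx, hy, h1, smul_smul, ← add_smul, ← sub_smul]

theorem gen_one_pow_mon (r p d i j : ℕ) : (genAux U r p 1 ^ d) (mon U (i, j)) =
    rise ((i : ℂ) + r * j - p) d • mon U (i + d, j) := by
  induction d with
  | zero => simp [rise]
  | succ d ih =>
    rw [pow_succ', Module.End.mul_apply, ih, map_smul, gen_one_mon, smul_smul, rise_succ, add_assoc]
    congr 2
    push_cast
    ring

theorem gen_two_pow_mon (r p n i j : ℕ) : (genAux U r p 2 ^ n) (mon U (i, j)) =
    ((i : ℂ) - p / 2) ^ n • mon U (i, j) := by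
  have h1 : genAux U r p 2 (mon U (i, j)) = ((i : ℂ) - p / 2) • mon U (i, j) := by
    have h : genAux U r p 2 (mon U (i, j)) = X U * Dx U (mon U (i, j))
        - ((p : ℂ) / 2) • mon U (i, j) := rfl
    have hx : X U * Dx U (mon U (i, j)) = (i : ℂ) • mon U (i, j) := by
      rw [Dx_mon, mul_smul_comm]
      rcases Nat.eq_zero_or_pos i with rfl | hi
      · simp
      · obtain ⟨i, rfl⟩ := Nat.exists_eq_add_of_le' hi
        congr 1
        simp only [mon, Nat.add_sub_cancel]
        ring
    rw [h, hx, ← sub_smul]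
  induction n with
  | zero => simp
  | succ n ih => rw [pow_succ', Module.End.mul_apply, ih, map_smul, h1, smul_smul, pow_succ]

theorem gen_three_pow_mon (r p n i j : ℕ) : (genAux U r p 3 ^ n) (mon U (i, j)) =
    (j : ℂ) ^ n • mon U (i, j) := by
  have h1 : genAux U r p 3 (mon U (i, j)) = (j : ℂ) • mon U (i, j) := by
    have h : genAux U r p 3 (mon U (i, j)) = Y U * Dy U (mon U (i, j)) := rfl
    rw [h, Dy_mon, mul_smul_comm]
    rcases Nat.eq_zero_or_pos j with rfl | hj
    · simp
    · obtain ⟨j, rfl⟩ := Nat.exists_eq_add_of_le' hj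
      congr 1
      simp only [mon, Nat.add_sub_cancel]
      ring
  induction n with
  | zero => simp
  | succ n ih => rw [pow_succ', Module.End.mul_apply, ih, map_smul, h1, smul_smul, pow_succ]

theorem gen_add_four_pow_mon (r p s n i j : ℕ) : (genAux U r p (s + 4) ^ n) (mon U (i, j)) =
    (j.descFactorial n : ℂ) • mon U (i + s * n, j - n) := by
  induction n with
  | zero => simp
  | succ n ih =>
    have h1 : ∀ i j, genAux U r p (s + 4) (mon U (i, j)) = (j : ℂ) • mon U (i + s, j - 1) := by
      intro i j
      have h : genAux U r p (s + 4) (mon U (i, j)) = X U ^ s * Dy U (mon U (i, j)) := rfl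
      rw [h, Dy_mon, mul_smul_comm]
      congr 1
      simp only [mon]
      ring
    rw [pow_succ', Module.End.mul_apply, ih, map_smul, h1, smul_smul, Nat.descFactorial_succ,
      Nat.sub_sub, mul_add, mul_one, add_assoc]
    push_cast
    rw [mul_comm]

theorem ofFn_gen_mon (r p n : ℕ) (g K : Fin n → ℕ) (i j : ℕ) :
    (List.ofFn fun s => genAux U r p (g s + 4) ^ K s).prod (mon U (i, j)) =
      (j.descFactorial (∑ s, K s) : ℂ) • mon U (i + ∑ s, g s * K s, j - ∑ s, K s) := by
  induction n with
  | zero => simp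
  | succ n ih =>
    rw [List.ofFn_succ, List.prod_cons, Module.End.mul_apply, ih (fun s => g s.succ)
      (fun s => K s.succ), map_smul, gen_add_four_pow_mon, smul_smul, Fin.sum_univ_succ,
      Fin.sum_univ_succ, ← descFactorial_add_cast, Nat.sub_sub, add_comm (K 0), add_assoc,
      add_comm (g 0 * K 0)]

theorem exists_exponents (r β a : ℕ) (h : a ≤ r * β) :
    ∃ κ : Fin (r + 1) → ℕ, ∑ s, κ s = β ∧ ∑ s : Fin (r + 1), (s : ℕ) * κ s = a := by
  induction β generalizing a with
  | zero => exact ⟨0, by simp, by simp; omega⟩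
  | succ β ih =>
    rw [mul_add, mul_one] at h
    -- Greedy choice: one factor `x^s ∂_y` takes `s = min a r`, and the rest is at most `r β`.
    obtain ⟨κ, h1, h2⟩ := ih (a - min a r) (by omega)
    refine ⟨κ + Pi.single ⟨min a r, by omega⟩ 1, ?_, ?_⟩
    · simp [Finset.sum_add_distrib, h1]
    · simp only [Pi.add_apply, mul_add, Finset.sum_add_distrib, h2]
      rw [Finset.sum_eq_single ⟨min a r, by omega⟩]
      · simp
      · intro s _ hs
        simp [hs]
      · simp

/-- The exponent of the monomial `(J^1)^α (J^2)^d (J^3)^m (J^4)^n ∏ (J^{5+s})^(κ s)`. -/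
def genExponent {r : ℕ} (α d m n : ℕ) (κ : Fin (r + 1) → ℕ) : Fin (r + 5) →₀ ℕ :=
  Finsupp.equivFunOnFinite.symm
    (Fin.cons α (Fin.cons d (Fin.cons m (Fin.cons n κ : Fin (r + 2) → ℕ) : Fin (r + 3) → ℕ) :
      Fin (r + 4) → ℕ) : Fin (r + 5) → ℕ)

theorem genExponent_degree {r : ℕ} (α d m n : ℕ) (κ : Fin (r + 1) → ℕ) :
    ((genExponent α d m n κ).sum fun _ k => k) = α + (d + (m + (n + ∑ s, κ s))) := by
  rw [Finsupp.sum_fintype _ _ (by simp), genExponent]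
  simp only [Finsupp.equivFunOnFinite_symm_apply_apply]
  rw [Fin.sum_univ_succ, Fin.cons_zero]
  simp only [Fin.cons_succ]
  rw [Fin.sum_univ_succ, Fin.cons_zero]
  simp only [Fin.cons_succ]
  rw [Fin.sum_univ_succ, Fin.cons_zero]
  simp only [Fin.cons_succ]
  rw [Fin.sum_univ_succ, Fin.cons_zero]
  simp only [Fin.cons_succ]

theorem gen_prod_genExponent {r : ℕ} (p α d m n : ℕ) (κ : Fin (r + 1) → ℕ) :
    (List.ofFn fun t => gen U r p t ^ genExponent α d m n κ t).prod =
      genAux U r p 0 ^ α * (genAux U r p 1 ^ d * (genAux U r p 2 ^ m * (genAux U r p 3 ^ n *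
        (List.ofFn fun s : Fin (r + 1) => genAux U r p (s + 4) ^ κ s).prod))) := by
  rw [List.ofFn_succ, List.prod_cons, List.ofFn_succ, List.prod_cons, List.ofFn_succ,
    List.prod_cons, List.ofFn_succ, List.prod_cons]
  rfl

theorem gen_prod_genExponent_mon {r : ℕ} (p α d m n : ℕ) (κ : Fin (r + 1) → ℕ) {a β : ℕ}
    (hβ : ∑ s, κ s = β) (ha : ∑ s : Fin (r + 1), (s : ℕ) * κ s = a) (i j : ℕ) :
    (List.ofFn fun t => gen U r p t ^ genExponent α d m n κ t).prod (mon U (i, j)) =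
      (((i + a + d).descFactorial α : ℂ) * rise (((i + a : ℕ) : ℂ) + r * (j - β : ℕ) - p) d *
        ((((i + a : ℕ) : ℂ) - p / 2) ^ m * ((j - β : ℕ) : ℂ) ^ n) * j.descFactorial β) •
        mon U (i + a + d - α, j - β) := by
  rw [gen_prod_genExponent, Module.End.mul_apply, Module.End.mul_apply, Module.End.mul_apply,
    Module.End.mul_apply, ofFn_gen_mon r p (r + 1) (fun s => (s : ℕ)), hβ, ha]
  simp only [map_smul, gen_three_pow_mon, gen_two_pow_mon, gen_one_pow_mon]
  simp only [genAux, Dx_pow_mon, smul_smul]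
  congr 1
  ring

/-- Homogeneous operators with prescribed polynomial symbol, as polynomials in the generators. -/
theorem exists_evalGen (r p α d a β : ℕ) (ha : a ≤ r * β) (ψ : MvPolynomial (Fin 2) ℂ) :
    ∃ P : MvPolynomial (Fin (r + 5)) ℂ, P.totalDegree ≤ α + d + β + ψ.totalDegree ∧
      ∀ i j : ℕ, evalGen U r p P (mon U (i, j)) =
        (((i + a + d).descFactorial α : ℂ) * rise (((i + a : ℕ) : ℂ) + r * (j - β : ℕ) - p) d *
          MvPolynomial.eval ![((i + a : ℕ) : ℂ) - p / 2, ((j - β : ℕ) : ℂ)] ψ *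
          j.descFactorial β) • mon U (i + a + d - α, j - β) := by
  obtain ⟨κ, hκ, hκ'⟩ := exists_exponents r β a ha
  -- The exponents of the two variables of `ψ` become those of `J^3` and `J^4`, which act after the
  -- factors `x^s ∂_y`; hence their eigenvalues at `(i + a, j - β)`.
  refine ⟨∑ s ∈ ψ.support, MvPolynomial.monomial (genExponent α d (s 0) (s 1) κ) (ψ.coeff s),
    ?_, fun i j => ?_⟩
  · refine MvPolynomial.totalDegree_finsetSum_le fun s hs => ?_
    refine (MvPolynomial.totalDegree_monomial_le _ _).trans ?_
    have h1 := MvPolynomial.le_totalDegree hs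
    rw [Finsupp.sum_fintype _ _ (by simp), Fin.sum_univ_two] at h1
    have h2 := genExponent_degree α d (s 0) (s 1) κ
    change ((genExponent α d (s 0) (s 1) κ).sum fun _ k => k) ≤ _
    rw [h2, hκ]
    omega
  · rw [evalGen_sum, LinearMap.sum_apply, MvPolynomial.eval_eq', Finset.mul_sum, Finset.sum_mul,
      Finset.sum_smul]
    refine Finset.sum_congr rfl fun s _ => ?_
    rw [evalGen_monomial, LinearMap.smul_apply, gen_prod_genExponent_mon p α d _ _ κ hκ hκ',
      smul_smul, Fin.prod_univ_two]
    congr 1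
    simp only [Matrix.cons_val_zero, Matrix.cons_val_one]
    ring

/-! ### Realizing operators by polynomials in the generators -/

/-- The core of the positive direction. On the staircase the component is `(J^1)^α (J^2)^d ψ(J^3,
J^4)` times `β` generators `x^s ∂_y`. The factorials and the rising product in its symbol match
these factors, and the degree left for `ψ` is `K - α - β - d`. -/
theorem exists_evalGen_of_shift {r p q K : ℕ} {G : (ℕ × ℕ) × (ℕ × ℕ) →₀ ℂ} {a b : ℤ}
    (hG : ∀ t ∈ G.support, shift t = (a, b)) (hK : ∀ t ∈ G.support, t.1.1 + t.1.2 ≤ K)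
    (h : ∀ e ∈ stairs r p q, symb G e ≠ 0 → ∀ m : ℕ × ℕ, (m.1 : ℤ) = e.1 + a →
      (m.2 : ℤ) = e.2 + b → m ∈ stairs r p q ∧ m.2 ≤ e.2) :
    ∃ P : MvPolynomial (Fin (r + 5)) ℂ, P.totalDegree ≤ K ∧
      ∀ e ∈ stairs r p q, evalGen U r p P (mon U e) = opOf U G (mon U e) := by
  by_cases hz : ∀ e ∈ stairs r p q, symb G e = 0
  · refine ⟨0, by simp, fun e he => ?_⟩
    rw [evalGen_zero, LinearMap.zero_apply, opOf_mon_of_shift hG, hz e he, zero_smul]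
  push Not at hz
  obtain ⟨e₀, he₀, hne⟩ := hz
  have hnn : ¬ ((e₀.1 : ℤ) + a < 0 ∨ (e₀.2 : ℤ) + b < 0) := fun hneg =>
    hne (symb_eq_zero_of_neg hG hneg)
  have hb := (h e₀ he₀ hne (((e₀.1 : ℤ) + a).toNat, ((e₀.2 : ℤ) + b).toNat)
    (by dsimp only; omega) (by dsimp only; omega)).2
  dsimp only at hb
  obtain ⟨β, rfl⟩ : ∃ β : ℕ, b = -(β : ℤ) := ⟨(-b).toNat, by omega⟩
  have hβ : β ≤ e₀.2 := by omega
  have hrβ : r * β ≤ r * e₀.2 := Nat.mul_le_mul_left r hβ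
  have hp : r * β ≤ p := by have := he₀.1; omega
  have hq : β ≤ q := hβ.trans he₀.2
  have hmul : ∀ j, β ≤ j → r * j = r * (j - β) + r * β := fun j hj => by
    rw [← mul_add, Nat.sub_add_cancel hj]
  -- The shift splits as `a = a₀ + d - α`: the factors `x^s ∂_y` contribute `a₀ ≤ r β`, `J^2` the
  -- excess `d`, and `∂_x` the drop `α`. If `α > 0` then `a₀ = d = 0`; if `d > 0` then `a₀ = r β`.
  obtain ⟨α, hα⟩ : ∃ α : ℕ, α = (-a).toNat := ⟨_, rfl⟩
  obtain ⟨d, hd⟩ : ∃ d : ℕ, d = (a - (r * β : ℕ)).toNat := ⟨_, rfl⟩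
  obtain ⟨a₀, ha₀⟩ : ∃ a₀ : ℕ, a₀ = min a.toNat (r * β) := ⟨_, rfl⟩
  have hle : ∀ t ∈ G.support, (α, β) ≤ t.1 := fun t ht => by
    have := hG t ht
    simp only [shift, Prod.mk.injEq] at this
    refine Prod.le_def.2 ⟨?_, ?_⟩ <;> dsimp only <;> omega
  have hαβ : α + β ≤ K := by
    obtain ⟨t, ht⟩ : G.support.Nonempty := by
      rw [Finsupp.support_nonempty_iff]
      rintro rfl
      exact hne (by simp [symb])
    have h1 := Prod.le_def.1 (hle t ht)
    have h2 := hK t ht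
    dsimp only at h1
    omega
  let φ : ℕ × ℕ → ℂ := ∑ t ∈ G.support, G t • fall (t.1 - (α, β))
  have hφ : ∀ e, symb G e = fall (α, β) e * φ (e - (α, β)) := fun e => by
    simp only [φ, Finset.sum_apply, Pi.smul_apply, smul_eq_mul, Finset.mul_sum]
    refine Finset.sum_congr rfl fun t ht => ?_
    dsimp only
    rw [fall_eq_mul (hle t ht)]
    ring
  have hφmem : φ ∈ adaptedLE r (p - r * β) (K - (α + β)) := by
    refine Submodule.sum_mem _ fun t ht => Submodule.smul_mem _ _
      (adaptedLE_mono ?_ (fall_mem_adaptedLE _ _ _))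
    have h1 := Prod.le_def.1 (hle t ht)
    have h2 := hK t ht
    simp only [Prod.fst_sub, Prod.snd_sub] at h1 ⊢
    omega
  -- After lowering `j` by `β` the staircase has parameters `p - r β` and `q - β`. On its top `d`
  -- levels the image monomial would have weight above `p`, so the symbol must vanish.
  have hφ0 : ∀ e ∈ stairs r (p - r * β) (q - β), p - r * β < e.1 + r * e.2 + d → φ e = 0 := by
    rintro ⟨i, j⟩ ⟨h1, h2⟩ h3
    dsimp only at h1 h2 h3
    have hα0 : α = 0 := by omega
    subst hα0
    by_contra hne'
    have he : (i, j + β) ∈ stairs r p q := ⟨by dsimp only; rw [mul_add]; omega, by dsimp only; omega⟩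
    have hs : symb G (i, j + β) ≠ 0 := by
      rw [hφ]
      refine mul_ne_zero (fall_ne_zero (Prod.mk_le_mk.2 ⟨by omega, by omega⟩)) ?_
      simpa using hne'
    have h4 := (h _ he hs (((i : ℤ) + a).toNat, j) (by dsimp only; omega)
      (by dsimp only; omega)).1.1
    dsimp only at h4
    omega
  -- The quotient is evaluated at `i - α`, whereas `J^3` has eigenvalue `i + a₀ - p / 2`; the
  -- constant is the difference.
  obtain ⟨ψ, hψ, hψe⟩ := exists_factor hφmem hφ0 ((α : ℂ) + a₀ - p / 2)
  rcases hψ with rfl | hψ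
  · refine ⟨0, by simp, fun e he => ?_⟩
    rw [evalGen_zero, LinearMap.zero_apply, opOf_mon_of_shift hG, hφ]
    by_cases hle' : (α, β) ≤ e
    · have h1 := Prod.le_def.1 hle'
      have h2 := hmul e.2 h1.2
      rw [hψe (e - (α, β)) ⟨?_, ?_⟩, map_zero, mul_zero, mul_zero, zero_smul]
      · have := he.1
        simp only [Prod.fst_sub, Prod.snd_sub]
        omega
      · have := he.2
        simp only [Prod.snd_sub]
        omega
    · rw [fall_eq_zero hle', zero_mul, zero_smul]
  obtain ⟨P, hP, hPe⟩ := exists_evalGen (U := U) r p α d a₀ β (ha₀ ▸ min_le_right _ _) ψ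
  refine ⟨P, by omega, ?_⟩
  rintro ⟨i, j⟩ he
  rw [hPe, opOf_mon_of_shift hG, hφ]
  by_cases hle' : (α, β) ≤ (i, j)
  · have h1 := Prod.mk_le_mk.1 hle'
    have h2 := hmul j h1.2
    have h3 := he.1
    have h4 := he.2
    dsimp only at h3 h4
    rw [hψe ((i, j) - (α, β)) ⟨by simp only [Prod.mk_sub_mk]; omega,
      by simp only [Prod.mk_sub_mk]; omega⟩]
    simp only [Prod.mk_sub_mk]
    have hm : (i + a₀ + d - α, j - β) = (((i : ℤ) + a).toNat, ((j : ℤ) + -(β : ℤ)).toNat) :=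
      Prod.ext (by dsimp only; omega) (by dsimp only; omega)
    have hev : ((i - α : ℕ) : ℂ) + ((α : ℂ) + a₀ - p / 2) = ((i + a₀ : ℕ) : ℂ) - p / 2 := by
      rw [Nat.cast_sub h1.1]
      push_cast
      ring
    have hdesc : (i + a₀ + d).descFactorial α = i.descFactorial α := by
      rcases Nat.eq_zero_or_pos α with h0 | h0
      · rw [h0, Nat.descFactorial_zero, Nat.descFactorial_zero]
      · congr 1
        omega
    -- When `d > 0`, the shift `a₀ = r β` turns the `p` of `J^2` into the `p - r β` of the lowered
    -- staircase.
    have hrise : rise (((i + a₀ : ℕ) : ℂ) + r * (j - β : ℕ) - p) d =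
        rise (((i - α : ℕ) : ℂ) + r * (j - β : ℕ) - (p - r * β : ℕ)) d := by
      rcases Nat.eq_zero_or_pos d with h0 | h0
      · rw [h0, rise, rise, Finset.prod_range_zero, Finset.prod_range_zero]
      · have hα0 : α = 0 := by omega
        have ha₀' : a₀ = r * β := by omega
        congr 1
        rw [hα0, ha₀', Nat.cast_sub hp, Nat.sub_zero]
        push_cast
        ring
    rw [hm, hev, hdesc, hrise]
    congr 1
    simp only [fall]
    ring
  -- Here the symbol vanishes, and so does a falling factorial on the side of the generators; if `i
  -- < α`, then `a₀ = d = 0`.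
  · rw [fall_eq_zero hle', zero_mul, zero_smul]
    rcases lt_or_ge j β with hj | hj
    · rw [Nat.descFactorial_eq_zero_iff_lt.2 hj, Nat.cast_zero, mul_zero, zero_smul]
    · have hi : i < α := by
        by_contra hi
        exact hle' (Prod.mk_le_mk.2 ⟨by omega, hj⟩)
      rw [Nat.descFactorial_eq_zero_iff_lt.2 (show i + a₀ + d < α by omega)]
      simp

theorem exists_evalGen_eq_on_stairs (hU : (U : Set (ℂ × ℂ)).Nonempty) {r p q k : ℕ}
    {T : Module.End ℂ (Smooth U)} (hT : T ∈ complementDown U r p q) (hk : T ∈ opsOfOrderLE U k) :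
    ∃ P : MvPolynomial (Fin (r + 5)) ℂ, P.totalDegree ≤ k ∧
      ∀ e ∈ stairs r p q, evalGen U r p P (mon U e) = T (mon U e) := by
  classical
  obtain ⟨L, hL⟩ := exists_coeff hU
  have hS : ∀ e ∈ stairs r p q, T (mon U e) ∈ stairModule U r p q := fun e he =>
    hT.1.1.2 _ (mon_mem_stairModule he)
  obtain ⟨G, hG, hGT⟩ := exists_opOf (stairs_isLowerSet r p q) hk fun e he =>
    stairModule_le_span r p q (hS e he)
  have hP : ∀ d : ℤ × ℤ, ∃ P : MvPolynomial (Fin (r + 5)) ℂ, P.totalDegree ≤ k ∧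
      ∀ e ∈ stairs r p q,
        evalGen U r p P (mon U e) = opOf U (G.filter (shift · = d)) (mon U e) := by
    rintro ⟨a, b⟩
    refine exists_evalGen_of_shift (a := a) (b := b) (fun t ht => ?_) (fun t ht => ?_) ?_
    · rw [Finsupp.support_filter, Finset.mem_filter] at ht
      exact ht.2
    · rw [Finsupp.support_filter, Finset.mem_filter] at ht
      exact (hG t ht.1).2
    · intro e he hne m h1 h2
      -- A nonzero symbol means that `x^m` occurs in the image of `x^e` under `T`, which lies in the
      -- staircase module and has `y`-degree at most `e.2`.
      rw [← coeff_opOf_mon (U := U) hL G (m := m) h1 h2, hGT e he] at hne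
      constructor
      · by_contra hm
        exact hne (coeff_eq_zero hL (hS e he) hm)
      · by_contra hm
        exact hne (coeff_eq_zero hL (apply_mon_mem_yLE hT.2 e) hm)
  choose P hPd hPe using hP
  refine ⟨∑ d ∈ G.support.image shift, P d,
    MvPolynomial.totalDegree_finsetSum_le fun d _ => hPd d, fun e he => ?_⟩
  rw [evalGen_sum, ← hGT e he, opOf_eq_sum_filter, LinearMap.sum_apply, LinearMap.sum_apply]
  exact Finset.sum_congr rfl fun d _ => hPe d e he

/-- Truncation does not raise the order, and `T` is the truncation of `D`. Applied to the evaluated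
polynomial, this shows that its degree cannot be below the order of `T`. -/
theorem mem_opsOfOrderLE_of_eq_on_stairs {r p q m : ℕ} {T D : Module.End ℂ (Smooth U)}
    (hT : T ∈ opsOn U (stairs r p q)) (hD : D ∈ opsOfOrderLE U m)
    (h : ∀ e ∈ stairs r p q, D (mon U e) = T (mon U e)) : T ∈ opsOfOrderLE U m := by
  obtain ⟨D', hD', hDD'⟩ := exists_truncation (stairs_isLowerSet r p q) hD
  have : T = D' := opsOn_ext (stairs_isLowerSet r p q) hT (opsOn_mono Set.inter_subset_left hD')
    fun e he => by rw [hDD' e he, h e he]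
  rw [this]
  exact opsOn_mono Set.inter_subset_right hD'

theorem exists_isProjection_evalGen (hU : (U : Set (ℂ × ℂ)).Nonempty) {r p q k : ℕ}
    {T : Module.End ℂ (Smooth U)} (hT : T ∈ complementDown U r p q) (hk : T ∈ opsOfOrderLE U k) :
    ∃ P : MvPolynomial (Fin (r + 5)) ℂ, P.totalDegree ≤ k ∧
      ((∀ m < k, T ∉ opsOfOrderLE U m) → P.totalDegree = k) ∧
      IsProjection U r p q (evalGen U r p P) T := by
  obtain ⟨P, hPk, hP⟩ := exists_evalGen_eq_on_stairs hU hT hk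
  have hord := evalGen_mem_opsOfOrderLE (U := U) r p P
  have hdiff := opsOfOrderLE_le_diffOps _ hord
  refine ⟨P, hPk, fun h => ?_, mem_preserving hdiff fun e he => ?_, hT.1,
    mem_kerRestrict (end_sub_mem hdiff hT.1.1.1) fun _ he => ?_⟩
  · by_contra hne
    exact h _ (lt_of_le_of_ne hPk hne) (mem_opsOfOrderLE_of_eq_on_stairs hT.1.2 hord hP)
  · rw [hP e he]
    exact hT.1.1.2 _ (mon_mem_stairModule he)
  · rw [LinearMap.sub_apply, hP _ he, sub_self]

/-- In low order nothing is truncated, so projecting a polynomial in the generators leaves it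
unchanged. -/
theorem opsOfOrderLE_le_opsOn_stairs {r p q k : ℕ} (hr : 1 ≤ r) (hkq : k ≤ q) (hkp : r * k ≤ p) :
    opsOfOrderLE U k ≤ opsOn U (stairs r p q) := by
  refine opsOn_mono fun e he => ?_
  have he' : e.1 + e.2 ≤ k := he
  refine ⟨le_trans ?_ hkp, by omega⟩
  calc e.1 + r * e.2 ≤ r * e.1 + r * e.2 := by gcongr; exact Nat.le_mul_of_pos_left _ hr
    _ = r * (e.1 + e.2) := (mul_add _ _ _).symm
    _ ≤ r * k := Nat.mul_le_mul_left r he'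

theorem IsProjection.eq {r p q : ℕ} {P T : Module.End ℂ (Smooth U)}
    (h : IsProjection U r p q P T) (hP : P ∈ opsOn U (stairs r p q)) : P = T :=
  opsOn_ext (stairs_isLowerSet r p q) hP h.2.1.2 fun _ he =>
    sub_eq_zero.1 (h.2.2.2 _ (mon_mem_stairModule he))

end Staircase

end

open Staircase in
theorem mainTheorem4 (U : TopologicalSpace.Opens (ℂ × ℂ)) (hU : (U : Set (ℂ × ℂ)).Nonempty)
    (r p q : ℕ) (hr : 2 ≤ r) :
    -- the distinguished complement is a complement of the kernel
    (Disjoint (complement U r p q) (kerRestrict U r p q) ∧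
      complement U r p q ⊔ kerRestrict U r p q = preserving U r p q) ∧
    -- low order: polynomials in the generators
    (∀ k : ℕ, k ≤ q → r * k ≤ p → ∀ T ∈ complementDown U r p q, T ∈ opsOfOrderLE U k →
      ∃ P : MvPolynomial (Fin (r + 5)) ℂ, P.totalDegree ≤ k ∧
        ((∀ m < k, T ∉ opsOfOrderLE U m) → P.totalDegree = k) ∧
        evalGen U r p P = T) ∧
    -- arbitrary order: projections of polynomials in the generators
    (∀ k : ℕ, ∀ T ∈ complementDown U r p q, T ∈ opsOfOrderLE U k →
      ∃ P : MvPolynomial (Fin (r + 5)) ℂ, P.totalDegree ≤ k ∧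
        ((∀ m < k, T ∉ opsOfOrderLE U m) → P.totalDegree = k) ∧
        IsProjection U r p q (evalGen U r p P) T) ∧
    -- operators that are not of nonpositive `y`-degree
    (∀ T ∈ complement U r p q, T ∉ complementDown U r p q → ¬ IsLieAlgebraic U r p q T) ∧
    (∀ T ∈ complement U r p q, T ≠ 0 → ∀ a b : ℤ, 0 < b → HasBidegree T a b →
      ¬ IsLieAlgebraic U r p q T) ∧
    -- the example `y ∂_x²`
    (r = 2 → 2 ≤ p → q = p / 2 →
      mulOp (Y U) * Dx U ^ 2 ∈ complement U r p q ∧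
      HasBidegree (mulOp (Y U) * Dx U ^ 2) (-2) 1 ∧
      ¬ IsLieAlgebraic U r p q (mulOp (Y U) * Dx U ^ 2)) := by
  refine ⟨⟨disjoint_complement_kerRestrict U r p q, complement_sup_kerRestrict U r p q⟩, ?_,
    fun k T hT hk => exists_isProjection_evalGen hU hT hk,
    fun T hT h => not_isLieAlgebraic_of_notMem hU hT h,
    fun T hT hT0 a b hb h => not_isLieAlgebraic_of_hasBidegree hU hT hT0 hb h, ?_⟩
  · intro k hkq hkp T hT hk
    obtain ⟨P, hPk, hPd, hP⟩ := exists_isProjection_evalGen hU hT hk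
    exact ⟨P, hPk, hPd, hP.eq (opsOfOrderLE_le_opsOn_stairs (by omega) hkq hkp
      (opsOfOrderLE_mono hPk (evalGen_mem_opsOfOrderLE r p P)))⟩
  · rintro rfl hp rfl
    have h := Y_mul_Dx_sq_mem_complement (U := U) hp
    exact ⟨h, hasBidegree_Y_mul_Dx_sq, not_isLieAlgebraic_of_hasBidegree hU h
      (Y_mul_Dx_sq_ne_zero hU) zero_lt_one hasBidegree_Y_mul_Dx_sq⟩
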